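/- Let $n\ge 0$ and let $X_1,\dots,X_n$ be independent real random variables with a common continuous distribution (that is, one without atoms). Let $S_0=0$ and $S_j=\sum_{i=1}^j X_i$ for $1\le j\le n$. Let $p_+\in[0,1]$ and suppose that $P(S_j>0)=p_+$ for every $1\le j\le n$; put $p_-=1-p_+$. The concave majorant $\bar C$ of the walk is the least concave function on $[0,n]$ with $\bar C(j)\ge S_j$ for all $0\le j\le n$. Its faces are the chords joining $(i,S_i)$ to $(k,S_k)$, where $i<k$ are successive elements of $\{j\in\{0,\dots,n\}: S_j=\bar C(j)\}$; such a face has length $k-i$ and slope $(S_k-S_i)/(k-i)$. Let $L_n=\arg\max_{0\le j\le n}S_j$, the almost surely unique time at which the walk attains its maximum (the first such time, say). For a real $\theta$, an integer $m\ge 0$ and a partition of $m$ with $a_j$ parts equal to $j$ (so $\sum_j j a_j=m$), the Ewens sampling formula with parameter $\theta$ is $$E_\theta(a_1,\dots,a_m)=\frac{m!}{\theta(\theta+1)\cdots(\theta+m-1)}\prod_{j=1}^{m}\frac{\theta^{a_j}}{j^{a_j}\,a_j!},$$ where $\theta(\theta+1)\cdots(\theta+m-1)=\Gamma(\theta+m)/\Gamma(\theta)$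 if $\theta>0$, and an empty product is $1$ (also, $0^0=1$). **Theorem.** Let $0\le\ell\le n$ with $P(L_n=\ell)>0$. 1. Conditionally given $L_n=\ell$, the partition of $\ell$ generated by the lengths of the faces of the concave majorant on the interval $[0,\ell]$ is distributed according to the Ewens sampling formula with parameter $p_+$: for every partition of $\ell$ with $a_j$ parts equal to $j$, the conditional probability that exactly $a_j$ faces contained in $[0,\ell]$ have length $j$, for every $j\ge1$, is $E_{p_+}(a_1,\dots,a_\ell)$. 2. The same holds with the faces of positive slope: if $A_j^+$ is the number of faces with positive slope and length $j$, then for all $(a_j)_{j\ge1}$ with $\sum_j j a_j=\ell$, $$P(A_j^+=a_j,\ j\ge 1\mid L_n=\ell)=E_{p_+}(a_1,\dots,a_\ell).$$ 3. Conditionally given $L_n=\ell$, the partition of $n-\ell$ generated by the lengths of the faces of the concave majorant on the interval $[\ell,n]$ is distributed according to the Ewens sampling formula with parameter $p_-$: for every partition of $n-\ell$ with $a_j$ parts equal to $j$, the conditional probability that exactly $a_j$ faces contained in $[\ell,n]$ have length $j$, for every $j\ge1$, is $E_{p_-}(a_1,\dots,a_{n-\ell})$. -/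

import Mathlib

open MeasureTheory ProbabilityTheory

/-- The walk with increments `x 0, …, x (n - 1)`: `walk x j` is the sum of the first `j` of them. -/
def walk {n : ℕ} (x : Fin n → ℝ) (j : ℕ) : ℝ :=
  ∑ i ∈ Finset.univ.filter (fun i : Fin n => (i : ℕ) < j), x i

/-- `C` is concave on `[0,n]` and `C j ≥ s j` for every integer `0 ≤ j ≤ n`. -/
def IsConcaveBound (n : ℕ) (s : ℕ → ℝ) (C : ℝ → ℝ) : Prop :=
  ConcaveOn ℝ (Set.Icc 0 (n : ℝ)) C ∧ ∀ j ≤ n, s j ≤ C j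

/-- The concave majorant of the points `(j, s j)`, `0 ≤ j ≤ n`: the least concave function on
`[0,n]` lying above them (see `concaveMajorant_isConcaveBound` and `concaveMajorant_le`). -/
noncomputable def concaveMajorant (n : ℕ) (s : ℕ → ℝ) (x : ℝ) : ℝ :=
  sInf {y | ∃ C, IsConcaveBound n s C ∧ C x = y}

theorem IsConcaveBound.min_le {n : ℕ} {s : ℕ → ℝ} {C : ℝ → ℝ} (h : IsConcaveBound n s C) {x : ℝ}
    (hx : x ∈ Set.Icc 0 (n : ℝ)) : min (s 0) (s n) ≤ C x := by
  have h0 : (0 : ℝ) ≤ n := Nat.cast_nonneg n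
  have h1 := h.1.ge_on_segment (Set.left_mem_Icc.2 h0) (Set.right_mem_Icc.2 h0)
    (by rw [segment_eq_Icc h0]; exact hx)
  have h2 : s 0 ≤ C 0 := by simpa using h.2 0 (Nat.zero_le n)
  exact (min_le_min h2 (h.2 n le_rfl)).trans h1

theorem concaveMajorant_le {n : ℕ} {s : ℕ → ℝ} {C : ℝ → ℝ} (h : IsConcaveBound n s C) {x : ℝ}
    (hx : x ∈ Set.Icc 0 (n : ℝ)) : concaveMajorant n s x ≤ C x := by
  refine csInf_le ⟨min (s 0) (s n), ?_⟩ ⟨C, h, rfl⟩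
  rintro y ⟨D, hD, rfl⟩
  exact hD.min_le hx

theorem exists_isConcaveBound (n : ℕ) (s : ℕ → ℝ) : ∃ C, IsConcaveBound n s C := by
  refine ⟨fun _ => ∑ j ∈ Finset.range (n + 1), |s j|, concaveOn_const _ (convex_Icc _ _), ?_⟩
  intro j hj
  exact (le_abs_self _).trans (Finset.single_le_sum (f := fun j => |s j|)
    (fun i _ => abs_nonneg _) (Finset.mem_range.2 (Nat.lt_succ_of_le hj)))

theorem concaveMajorant_isConcaveBound (n : ℕ) (s : ℕ → ℝ) :
    IsConcaveBound n s (concaveMajorant n s) := by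
  obtain ⟨C₀, hC₀⟩ := exists_isConcaveBound n s
  refine ⟨⟨convex_Icc _ _, ?_⟩, ?_⟩
  · intro x hx y hy a b ha hb hab
    refine le_csInf ⟨_, C₀, hC₀, rfl⟩ ?_
    rintro z ⟨C, hC, rfl⟩
    refine le_trans ?_ (hC.1.2 hx hy ha hb hab)
    have h1 := mul_le_mul_of_nonneg_left (concaveMajorant_le hC hx) ha
    have h2 := mul_le_mul_of_nonneg_left (concaveMajorant_le hC hy) hb
    simp only [smul_eq_mul]
    linarith
  · intro j hj
    refine le_csInf ⟨_, C₀, hC₀, rfl⟩ ?_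
    rintro z ⟨C, hC, rfl⟩
    exact hC.2 j hj

open Classical in
/-- The times `0 ≤ j ≤ n` at which the walk meets its concave majorant. -/
noncomputable def contactTimes (n : ℕ) (s : ℕ → ℝ) : Finset ℕ :=
  {j ∈ Finset.range (n + 1) | s j = concaveMajorant n s j}

/-- The faces of the concave majorant, as pairs (start, end) of successive contact times. -/
noncomputable def majorantFaces (n : ℕ) (s : ℕ → ℝ) : Finset (ℕ × ℕ) :=
  {e ∈ contactTimes n s ×ˢ contactTimes n s |
    e.1 < e.2 ∧ ∀ k ∈ contactTimes n s, ¬ (e.1 < k ∧ k < e.2)}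

/-- The length of a face (which has `e.1 < e.2`). -/
def faceLength (e : ℕ × ℕ) : ℕ := e.2 - e.1

noncomputable def faceSlope (s : ℕ → ℝ) (e : ℕ × ℕ) : ℝ :=
  (s e.2 - s e.1) / (faceLength e : ℝ)

/-- The multiset of lengths of the faces of the concave majorant on `[0,n]` that lie in the
interval `[a,b]`. -/
noncomputable def faceLengthsOn (n : ℕ) (s : ℕ → ℝ) (a b : ℕ) : Multiset ℕ :=
  Multiset.map faceLength {e ∈ majorantFaces n s | a ≤ e.1 ∧ e.2 ≤ b}.val

open Classical in
/-- The number of faces of length `j` with positive slope. -/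
noncomputable def posFaceCount (n : ℕ) (s : ℕ → ℝ) (j : ℕ) : ℕ :=
  Finset.card {e ∈ majorantFaces n s | faceLength e = j ∧ 0 < faceSlope s e}

/-- The (first) time in `{0, …, n}` at which `s` attains its maximum over `{0, …, n}`. -/
noncomputable def argmaxTime (n : ℕ) (s : ℕ → ℝ) : ℕ :=
  sInf {k | k ≤ n ∧ ∀ j ≤ n, s j ≤ s k}

/-- The Ewens sampling formula with parameter `θ`: the probability of the partition `π` of `m`,
`m! / (θ (θ + 1) ⋯ (θ + m - 1)) * ∏ j, θ ^ a j / (j ^ a j * (a j)!)`, where `a j` is the number of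
parts of `π` equal to `j`. -/
noncomputable def ewensFormula (θ : ℝ) {m : ℕ} (π : m.Partition) : ℝ :=
  (m.factorial : ℝ) / (∏ i ∈ Finset.range m, (θ + i)) *
    ∏ j ∈ Finset.Icc 1 m, θ ^ π.parts.count j /
      ((j : ℝ) ^ π.parts.count j * ((π.parts.count j).factorial : ℝ))

/-- For `θ > 0` the rising factorial is a quotient of Gamma values. -/
theorem ewensFormula_eq_Gamma {θ : ℝ} (hθ : 0 < θ) {m : ℕ} (π : m.Partition) :
    ewensFormula θ π = Real.Gamma θ * m.factorial / Real.Gamma (θ + m) *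
      ∏ j ∈ Finset.Icc 1 m, θ ^ π.parts.count j /
        ((j : ℝ) ^ π.parts.count j * ((π.parts.count j).factorial : ℝ)) := by
  have key : ∀ k : ℕ, Real.Gamma (θ + k) = (∏ i ∈ Finset.range k, (θ + i)) * Real.Gamma θ := by
    intro k
    induction k with
    | zero => simp
    | succ k ih =>
      have hk : θ + (k : ℝ) ≠ 0 := by positivity
      rw [Finset.prod_range_succ, Nat.cast_succ, ← add_assoc, Real.Gamma_add_one hk, ih]
      ring
  have hG : Real.Gamma θ ≠ 0 := (Real.Gamma_pos_of_pos hθ).ne'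
  rw [ewensFormula, key m, mul_comm (Real.Gamma θ), mul_div_mul_right _ _ hG]

/-! A composition `c` of `m` is the face structure of a walk exactly when, over every block, the
walk stays strictly below its chord and the chord slopes strictly decrease from block to block;
`FaceEvent c A` adds that all slopes lie in `A`. Blocks are independent, so its probability is that
of independent slopes, each taken under a finite law `faceLaw`, falling in decreasing order
(`pi_faceEvent`). Summing over all compositions with the same multiset of parts removes the order,
up to the factor `∏ a_j!` counting permutations of equal parts (`sum_orderedMass_arrangements`). By
the cyclic lemma `pi_belowChord`, a block of length `k` has mass `θ / k`, where `θ` is the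
probability that the mean of `k` increments lies in `A`. Hence a partition has total mass `∏ θ ^ a_j
/ (j ^ a_j * a_j!)`, the unnormalised Ewens weight (`sum_faceEvent_of_partition`).

For `A = univ` and `θ = 1` these weights sum to one, so almost every walk lies in some `FaceEvent`
(`ae_exists_mem_faceEvent`). Tangent lines and chords identify the block ends with the contact times
of the concave majorant. The first maximum is at `l` precisely when the faces before `l` have slopes
in `(0, ∞)` and those after have slopes in `(-∞, 0]`. The two stretches are independent, so the
joint probability factors; dividing by the probability of the conditioning event cancels the factor
of the other side and leaves Ewens weights over their sum. -/

theorem walk_zero {n : ℕ} (x : Fin n → ℝ) : walk x 0 = 0 := by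
  simp [walk]

theorem walk_succ {n : ℕ} (x : Fin n → ℝ) (j : ℕ) (hj : j < n) :
    walk x (j + 1) = walk x j + x ⟨j, hj⟩ := by
  unfold walk
  have : Finset.univ.filter (fun i : Fin n => (i : ℕ) < j + 1)
      = insert ⟨j, hj⟩ (Finset.univ.filter (fun i : Fin n => (i : ℕ) < j)) := by
    ext i
    simp only [Finset.mem_filter, Finset.mem_univ, true_and, Finset.mem_insert, Fin.ext_iff]
    omega
  rw [this, Finset.sum_insert (by simp), add_comm]

theorem walk_self {n : ℕ} (x : Fin n → ℝ) : walk x n = ∑ i, x i := by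
  simp [walk]

theorem measurable_walk {n : ℕ} (j : ℕ) : Measurable (fun x : Fin n → ℝ => walk x j) := by
  unfold walk
  fun_prop

theorem measurePreserving_comp_equiv {ι κ : Type*} [Fintype ι] [Fintype κ] (ν : κ → Measure ℝ)
    [∀ i, SigmaFinite (ν i)] (e : ι ≃ κ) :
    MeasurePreserving (fun (x : κ → ℝ) i => x (e i)) (Measure.pi ν)
      (Measure.pi fun i => ν (e i)) :=
  (measurePreserving_piCongrLeft ν e).symm

/-! ### Linear forms without atoms -/

/-- A nontrivial linear form of independent atomless variables has no atoms. -/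
theorem pi_linear_eq_null {r : ℕ} (ν : Fin r → Measure ℝ) [∀ i, IsFiniteMeasure (ν i)]
    [∀ i, NullSingletonClass (ν i)] (c : Fin r → ℝ) {i : Fin r} (hi : c i ≠ 0) (d : ℝ) :
    Measure.pi ν {x | ∑ j, c j * x j = d} = 0 := by
  obtain _ | r := r
  · exact i.elim0
  have hm : MeasurableSet {x : Fin (r + 1) → ℝ | ∑ j, c j * x j = d} :=
    measurableSet_eq_fun (by fun_prop) measurable_const
  -- Fubini with coordinate `i` singled out: once the others are fixed, the equation determines it,
  -- and a single value is null.
  have hp := (measurePreserving_piFinSuccAbove ν i).symm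
  rw [← hp.measure_preimage hm.nullMeasurableSet,
    Measure.prod_apply_symm (hp.measurable hm)]
  refine lintegral_eq_zero_of_ae_eq_zero (Filter.Eventually.of_forall fun y => ?_)
  refine measure_mono_null (t := {(d - ∑ j, c (i.succAbove j) * y j) / c i}) ?_ (measure_singleton _)
  intro t ht
  simp only [Set.mem_preimage, Set.mem_ofPred_eq, MeasurableEquiv.piFinSuccAbove_symm_apply,
    Fin.sum_univ_succAbove _ i, Fin.insertNthEquiv_apply, Fin.insertNth_apply_same,
    Fin.insertNth_apply_succAbove] at ht
  rw [Set.mem_singleton_iff, eq_div_iff hi]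
  linarith

/-! ### The cyclic lemma -/

/-- The walk lies strictly below the chord joining its end points. -/
def BelowChord {k : ℕ} (y : Fin k → ℝ) : Prop :=
  ∀ j, 0 < j → j < k → walk y j * k < j * walk y k

/-- The mean of the increments, the slope of the chord joining the end points of the walk. -/
noncomputable def chordSlope {k : ℕ} (y : Fin k → ℝ) : ℝ := walk y k / k

theorem measurable_chordSlope {k : ℕ} : Measurable (chordSlope (k := k)) :=
  (measurable_walk k).div_const _

theorem measurableSet_belowChord {k : ℕ} : MeasurableSet {y : Fin k → ℝ | BelowChord y} := by
  simp only [BelowChord, Set.ofPred_forall]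
  exact MeasurableSet.iInter fun j => MeasurableSet.iInter fun _ => MeasurableSet.iInter fun _ =>
    measurableSet_lt ((measurable_walk j).mul_const _) ((measurable_walk k).const_mul _)

/-- Potential of the centred increments on the cycle. -/
noncomputable def bridge {k : ℕ} (y : Fin k → ℝ) (a : Fin k) : ℝ := walk y a - a * chordSlope y

/-- Addition in `Fin (m + 1)` wraps around; the relation survives at the last index because the
centred increments sum to zero. -/
theorem bridge_add_one {m : ℕ} (y : Fin (m + 1) → ℝ) (a : Fin (m + 1)) :
    bridge y (a + 1) = bridge y a + (y a - chordSlope y) := by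
  rcases Fin.eq_castSucc_or_eq_last a with ⟨b, rfl⟩ | rfl
  · have h : ((b.castSucc + 1 : Fin (m + 1)) : ℕ) = b + 1 := by simp
    unfold bridge
    rw [h, Fin.val_castSucc, walk_succ y b (by omega)]
    push_cast
    have : (⟨(b : ℕ), by omega⟩ : Fin (m + 1)) = b.castSucc := rfl
    rw [this]
    ring
  · have h := walk_succ y m (by omega)
    have h2 : chordSlope y * ((m : ℝ) + 1) = walk y (m + 1) := by
      unfold chordSlope
      push_cast
      field_simp
    have : (⟨m, by omega⟩ : Fin (m + 1)) = Fin.last m := rfl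
    rw [this] at h
    unfold bridge
    simp only [Fin.last_add_one, Fin.val_zero, walk_zero, Fin.val_last]
    push_cast
    linarith

theorem chordSlope_rotate {m : ℕ} (y : Fin (m + 1) → ℝ) (a : Fin (m + 1)) :
    chordSlope (fun i => y (i + a)) = chordSlope y := by
  unfold chordSlope
  rw [walk_self, walk_self, ← Equiv.sum_comp (Equiv.addRight a) y]
  rfl

theorem walk_rotate {m : ℕ} (y : Fin (m + 1) → ℝ) (a : Fin (m + 1)) (b : Fin (m + 1)) :
    walk (fun i => y (i + a)) b = bridge y (b + a) - bridge y a + b * chordSlope y := by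
  induction b using Fin.induction with
  | zero => simp [walk_zero]
  | succ b ih =>
    have h1 : b.succ + a = (b.castSucc + a) + 1 := by
      rw [← Fin.coeSucc_eq_succ]
      abel
    rw [h1, bridge_add_one, Fin.val_succ, walk_succ _ _ (by omega)]
    rw [Fin.val_castSucc] at ih
    rw [ih]
    have : (⟨(b : ℕ), by omega⟩ : Fin (m + 1)) = b.castSucc := rfl
    simp only [this]
    push_cast
    ring

/-- After rotation to start at `a`, the height above the chord at step `j` is `bridge y (j + a) -
bridge y a`. So a good rotation is one starting at the strict maximum of the bridge, and at most one
exists. -/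
theorem belowChord_rotate_iff {m : ℕ} (y : Fin (m + 1) → ℝ) (a : Fin (m + 1)) :
    BelowChord (fun i => y (i + a)) ↔ ∀ b, b ≠ a → bridge y b < bridge y a := by
  have key : ∀ j (hj : j < m + 1), (walk (fun i => y (i + a)) j * ((m + 1 : ℕ) : ℝ)
      < j * walk (fun i => y (i + a)) (m + 1)) ↔
      bridge y (⟨j, hj⟩ + a) < bridge y a := by
    intro j hj
    have h1 := walk_rotate y a ⟨j, hj⟩
    have h2 : walk (fun i => y (i + a)) (m + 1) = chordSlope y * ((m + 1 : ℕ) : ℝ) := by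
      rw [← chordSlope_rotate y a, chordSlope, div_mul_cancel₀]
      positivity
    have h3 : (0 : ℝ) < ((m + 1 : ℕ) : ℝ) := by positivity
    simp only at h1
    rw [h2, h1, ← mul_assoc, mul_lt_mul_iff_left₀ h3]
    constructor <;> intro h <;> linarith
  constructor
  · intro h b hb
    have hne : b - a ≠ 0 := sub_ne_zero.2 hb
    have := (key (b - a : Fin (m + 1)) (b - a).2).1
      (h _ (Nat.pos_of_ne_zero fun h0 => hne (Fin.ext h0)) (b - a).2)
    simpa using this
  · intro h j hj0 hj
    refine (key j hj).2 (h _ ?_)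
    intro h0
    have h4 : (⟨j, hj⟩ : Fin (m + 1)) = 0 := by simpa using h0
    have := congrArg Fin.val h4
    simp at this
    omega

theorem bridge_eq_null {m : ℕ} (μ : Measure ℝ) [IsProbabilityMeasure μ] [NullSingletonClass μ]
    {a b : Fin (m + 1)} (hab : a < b) :
    Measure.pi (fun _ : Fin (m + 1) => μ) {y | bridge y a = bridge y b} = 0 := by
  have hab' : (a : ℕ) < b := hab
  -- Coefficients of `bridge y b - bridge y a`. The one at `a` is `1 - (b - a) / (m + 1)`, positive
  -- since `b < m + 1`.
  let c : Fin (m + 1) → ℝ := fun i =>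
    (if (i : ℕ) < b then 1 else 0) - (if (i : ℕ) < a then 1 else 0) - ((b : ℝ) - a) / (m + 1)
  have hc : c a ≠ 0 := by
    have h1 : ((b : ℝ) - a) / (m + 1) < 1 := by
      rw [div_lt_one (by positivity)]
      have h2 : ((b : ℕ) : ℝ) < m + 1 := by exact_mod_cast b.2
      have h3 : (0 : ℝ) ≤ (a : ℕ) := by positivity
      linarith
    simp only [c, hab', lt_irrefl, if_true, if_false]
    intro h
    linarith
  refine measure_mono_null ?_ (pi_linear_eq_null _ c hc 0)
  intro y hy
  simp only [Set.mem_ofPred_eq, bridge, chordSlope] at hy ⊢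
  have h1 : ∀ j : ℕ, walk y j = ∑ i : Fin (m + 1), (if (i : ℕ) < j then 1 else 0) * y i := by
    intro j
    simp [walk, Finset.sum_filter]
  simp only [c, sub_mul, Finset.sum_sub_distrib, ← h1, ← Finset.mul_sum]
  rw [← walk_self]
  push_cast at hy
  linear_combination -hy

/-- The cyclic lemma: among the rotations of the increments, almost surely exactly one gives a walk
below its chord. -/
theorem pi_belowChord {k : ℕ} (hk : 0 < k) (μ : Measure ℝ) [IsProbabilityMeasure μ] [NullSingletonClass μ]
    {A : Set ℝ} (hA : MeasurableSet A) :
    (k : ENNReal) * Measure.pi (fun _ : Fin k => μ) {y | BelowChord y ∧ chordSlope y ∈ A}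
      = Measure.pi (fun _ : Fin k => μ) {y | chordSlope y ∈ A} := by
  obtain ⟨m, rfl⟩ : ∃ m, k = m + 1 := ⟨k - 1, by omega⟩
  set M := Measure.pi (fun _ : Fin (m + 1) => μ)
  let U : Set (Fin (m + 1) → ℝ) := {y | BelowChord y ∧ chordSlope y ∈ A}
  have hU : MeasurableSet U := measurableSet_belowChord.inter (measurable_chordSlope hA)
  let R : Fin (m + 1) → (Fin (m + 1) → ℝ) → Fin (m + 1) → ℝ := fun a y i => y (i + a)
  have hR : ∀ a, MeasurePreserving (R a) M M := fun a =>
    measurePreserving_comp_equiv (fun _ => μ) (Equiv.addRight a)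
  have hmem : ∀ a y, y ∈ R a ⁻¹' U ↔
      (∀ b, b ≠ a → bridge y b < bridge y a) ∧ chordSlope y ∈ A := by
    intro a y
    simp only [R, U, Set.mem_preimage, Set.mem_ofPred_eq, belowChord_rotate_iff, chordSlope_rotate]
  have hdisj : Pairwise (Function.onFun Disjoint fun a => R a ⁻¹' U) := by
    intro a b hab
    refine Set.disjoint_left.2 fun y ha hb => ?_
    exact lt_asymm (((hmem a y).1 ha).1 b hab.symm) (((hmem b y).1 hb).1 a hab)
  have h1 : M (⋃ a, R a ⁻¹' U) = ((m + 1 : ℕ) : ENNReal) * M U := by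
    rw [measure_iUnion hdisj fun a => (hR a).measurable hU, tsum_fintype]
    simp only [(hR _).measure_preimage hU.nullMeasurableSet]
    simp
  rw [← h1]
  refine measure_congr ?_
  -- Ties in the bridge are null, so its maximum is almost surely strict and some rotation works.
  have hne : ∀ᵐ y ∂M, ∀ a b, a < b → bridge y a ≠ bridge y b := by
    rw [ae_all_iff]; intro a
    rw [ae_all_iff]; intro b
    by_cases hab : a < b
    · filter_upwards [measure_eq_zero_iff_ae_notMem.1 (bridge_eq_null μ hab)] with y hy _ using hy
    · simp [hab]
  filter_upwards [hne] with y hy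
  refine propext ⟨fun h => ?_, fun h => ?_⟩
  · obtain ⟨a, ha⟩ := Set.mem_iUnion.1 h
    exact ((hmem a y).1 ha).2
  · obtain ⟨a, -, ha⟩ := Finset.exists_max_image Finset.univ (bridge y) Finset.univ_nonempty
    refine Set.mem_iUnion.2 ⟨a, (hmem a y).2 ⟨fun b hb => ?_, h⟩⟩
    refine lt_of_le_of_ne (ha b (Finset.mem_univ _)) ?_
    rcases lt_or_gt_of_ne hb with h' | h'
    · exact hy _ _ h'
    · exact (hy _ _ h').symm

/-! ### The probability of a face structure -/

/-- The law of the slope of a walk of length `k`, restricted to the walks below their chord. -/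
noncomputable def faceLaw (μ : Measure ℝ) (k : ℕ) : Measure ℝ :=
  ((Measure.pi fun _ : Fin k => μ).restrict {y | BelowChord y}).map chordSlope

theorem faceLaw_apply (μ : Measure ℝ) (k : ℕ) {A : Set ℝ} (hA : MeasurableSet A) :
    faceLaw μ k A = Measure.pi (fun _ : Fin k => μ) {y | BelowChord y ∧ chordSlope y ∈ A} := by
  rw [faceLaw, Measure.map_apply measurable_chordSlope hA,
    Measure.restrict_apply (measurable_chordSlope hA), Set.inter_comm]
  rfl

instance (μ : Measure ℝ) [IsProbabilityMeasure μ] (k : ℕ) : IsFiniteMeasure (faceLaw μ k) := by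
  unfold faceLaw
  infer_instance

/-- A prescribed slope fixes the sum of the increments. For `k = 0` the law is a point mass at `0`,
hence the positivity assumption. -/
theorem nullSingletonClass_faceLaw (μ : Measure ℝ) [IsProbabilityMeasure μ] [NullSingletonClass μ]
    {k : ℕ} (hk : 0 < k) : NullSingletonClass (faceLaw μ k) := by
  refine ⟨fun t => ?_⟩
  rw [faceLaw_apply μ k (measurableSet_singleton t)]
  refine measure_mono_null ?_
    (pi_linear_eq_null (fun _ : Fin k => μ) (fun _ => 1) (i := ⟨0, hk⟩) one_ne_zero (k * t))
  rintro y ⟨-, hy⟩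
  have hk' : (k : ℝ) ≠ 0 := by exact_mod_cast hk.ne'
  simp only [Set.mem_singleton_iff, chordSlope, walk_self, div_eq_iff hk'] at hy
  simp only [Set.mem_ofPred_eq, one_mul, hy]
  exact mul_comm _ _

/-- The increments `x` give a walk whose faces have the successive lengths of `c`, and slopes in
`A`. -/
def FaceEvent {m : ℕ} (c : Composition m) (A : Set ℝ) : Set (Fin m → ℝ) :=
  {x | (∀ i, BelowChord (x ∘ c.embedding i)) ∧
    StrictAnti (fun i => chordSlope (x ∘ c.embedding i)) ∧
    ∀ i, chordSlope (x ∘ c.embedding i) ∈ A}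

/-- Strictly decreasing tuples with entries in `A`. -/
def decreasingTuples (r : ℕ) (A : Set ℝ) : Set (Fin r → ℝ) :=
  {t | StrictAnti t ∧ ∀ i, t i ∈ A}

theorem measurableSet_decreasingTuples (r : ℕ) {A : Set ℝ} (hA : MeasurableSet A) :
    MeasurableSet (decreasingTuples r A) := by
  simp only [decreasingTuples, StrictAnti, Set.ofPred_and, Set.ofPred_forall]
  refine .inter (.iInter fun a => .iInter fun b => .iInter fun _ => measurableSet_lt (by fun_prop)
    (by fun_prop)) (.iInter fun i => ?_)
  exact measurable_pi_apply i hA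

theorem measurableSet_faceEvent {m : ℕ} (c : Composition m) {A : Set ℝ} (hA : MeasurableSet A) :
    MeasurableSet (FaceEvent c A) := by
  have h : ∀ i, Measurable fun x : Fin m → ℝ => x ∘ c.embedding i := fun i => by
    unfold Function.comp; fun_prop
  have h2 : Measurable fun (x : Fin m → ℝ) i => chordSlope (x ∘ c.embedding i) :=
    measurable_pi_lambda _ fun i => measurable_chordSlope.comp (h i)
  have h3 : FaceEvent c A = (⋂ i, (fun x : Fin m → ℝ => x ∘ c.embedding i) ⁻¹' {y | BelowChord y})
      ∩ (fun (x : Fin m → ℝ) i => chordSlope (x ∘ c.embedding i)) ⁻¹' decreasingTuples _ A := by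
    ext x
    simp [FaceEvent, decreasingTuples]
  rw [h3]
  exact .inter (.iInter fun i => h i measurableSet_belowChord)
    (h2 (measurableSet_decreasingTuples _ hA))

theorem measurePreserving_blocks (μ : Measure ℝ) [IsProbabilityMeasure μ] {m : ℕ}
    (c : Composition m) :
    MeasurePreserving (fun (x : Fin m → ℝ) i j => x (c.embedding i j))
      (Measure.pi fun _ : Fin m => μ)
      (Measure.pi fun i => Measure.pi fun _ : Fin (c.blocksFun i) => μ) := by
  have h1 := measurePreserving_comp_equiv (fun _ : Fin m => μ) c.blocksFinEquiv
  have h2 := Measure.infinitePi_map_piCurry (X := fun i : Fin c.length =>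
    fun _ : Fin (c.blocksFun i) => ℝ) (fun _ _ => μ)
  simp only [Measure.infinitePi_eq_pi] at h2
  exact (MeasurePreserving.mk (MeasurableEquiv.measurable _) h2).comp h1

/-- Cutting the increments into blocks gives a product measure. The below-chord conditions restrict
each factor separately, so only the ordering and range of the slopes remain after pushing forward.
-/
theorem pi_faceEvent (μ : Measure ℝ) [IsProbabilityMeasure μ] {m : ℕ} (c : Composition m)
    {A : Set ℝ} (hA : MeasurableSet A) :
    Measure.pi (fun _ : Fin m => μ) (FaceEvent c A)
      = Measure.pi (fun i => faceLaw μ (c.blocksFun i)) (decreasingTuples c.length A) := by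
  have h1 := measurePreserving_blocks μ c
  let M : ∀ i : Fin c.length, Measure (Fin (c.blocksFun i) → ℝ) :=
    fun i => Measure.pi fun _ : Fin (c.blocksFun i) => μ
  let D : ∀ i : Fin c.length, Set (Fin (c.blocksFun i) → ℝ) := fun i => {y | BelowChord y}
  have hD : ∀ i, MeasurableSet (D i) := fun i => measurableSet_belowChord
  let T : (∀ i : Fin c.length, Fin (c.blocksFun i) → ℝ) → Fin c.length → ℝ :=
    fun z i => chordSlope (z i)
  have hT : Measurable T :=
    measurable_pi_lambda _ fun i => measurable_chordSlope.comp (measurable_pi_apply i)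
  have hDA := measurableSet_decreasingTuples c.length hA
  have h2 : Measure.pi (fun i => faceLaw μ (c.blocksFun i))
      = ((Measure.pi M).restrict (Set.univ.pi D)).map T := by
    rw [Measure.restrict_pi_pi]
    exact (Measure.pi_map_pi fun i => measurable_chordSlope.aemeasurable).symm
  rw [h2, Measure.map_apply hT hDA, Measure.restrict_apply (hT hDA),
    ← h1.measure_preimage ((hT hDA).inter (.univ_pi hD)).nullMeasurableSet]
  congr 1
  ext x
  simp only [FaceEvent, decreasingTuples, Set.mem_ofPred_eq, Set.mem_preimage, Set.mem_inter_iff,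
    Set.mem_univ_pi, T, D]
  exact and_comm

/-! ### Removing the order of the faces -/

theorem exists_perm_strictAnti {r : ℕ} {t : Fin r → ℝ} (ht : Function.Injective t) :
    ∃ ρ : Equiv.Perm (Fin r), StrictAnti (t ∘ ρ) := by
  refine ⟨Tuple.sort (fun i => -t i), fun a b hab => ?_⟩
  have h := Tuple.monotone_sort (fun i => -t i) hab.le
  simp only [Function.comp_apply, neg_le_neg_iff] at h ⊢
  exact lt_of_le_of_ne h fun h' => hab.ne ((Tuple.sort _).injective (ht h')).symm

theorem perm_eq_of_strictAnti {r : ℕ} {t : Fin r → ℝ} {ρ σ : Equiv.Perm (Fin r)}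
    (hρ : StrictAnti (t ∘ ρ)) (hσ : StrictAnti (t ∘ σ)) : ρ = σ := by
  have ht : Function.Injective t := by
    intro a b hab
    have := hρ.injective (a₁ := ρ.symm a) (a₂ := ρ.symm b) (by simpa using hab)
    exact ρ.symm.injective this
  refine Equiv.ext fun i => ht ?_
  exact congrFun (Tuple.unique_antitone hρ.antitone hσ.antitone) i

/-- Summing over all orders of independent atomless variables the probability that they are
decreasing removes the order constraint. -/
theorem sum_perm_decreasingTuples {r : ℕ} (ν : Fin r → Measure ℝ) [∀ i, IsFiniteMeasure (ν i)]
    [∀ i, NullSingletonClass (ν i)] {A : Set ℝ} (hA : MeasurableSet A) :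
    ∑ ρ : Equiv.Perm (Fin r), Measure.pi (fun i => ν (ρ i)) (decreasingTuples r A)
      = ∏ i, ν i A := by
  have hD := measurableSet_decreasingTuples r hA
  have hmp := fun ρ : Equiv.Perm (Fin r) => measurePreserving_comp_equiv ν ρ
  have hmem : ∀ (ρ : Equiv.Perm (Fin r)) (t : Fin r → ℝ),
      t ∈ (fun (x : Fin r → ℝ) i => x (ρ i)) ⁻¹' decreasingTuples r A ↔
        StrictAnti (t ∘ ρ) ∧ ∀ i, t i ∈ A := by
    intro ρ t
    simp only [decreasingTuples, Set.mem_preimage, Set.mem_ofPred_eq,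
      ρ.surjective.forall (p := fun i => t i ∈ A)]
    rfl
  rw [← Measure.pi_pi]
  simp only [← (hmp _).measure_preimage hD.nullMeasurableSet]
  rw [← tsum_fintype (L := .unconditional _), ← measure_iUnion ?_ fun ρ => (hmp ρ).measurable hD]
  · refine measure_congr ?_
    -- Coordinates are almost surely distinct, so exactly one permutation sorts them: the events
    -- indexed by `ρ` partition the box up to a null set.
    have hinj : ∀ᵐ t ∂Measure.pi ν, ∀ a b, a ≠ b → t a ≠ t b := by
      rw [ae_all_iff]; intro a
      rw [ae_all_iff]; intro b
      by_cases hab : a = b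
      · simp [hab]
      · let c : Fin r → ℝ := Pi.single a 1 - Pi.single b 1
        have hc : c a ≠ 0 := by simp [c, hab]
        filter_upwards [measure_eq_zero_iff_ae_notMem.1 (pi_linear_eq_null ν c hc 0)]
          with t ht _ h
        refine ht ?_
        simp [c, sub_mul, Finset.sum_sub_distrib, Pi.single_apply, h]
    filter_upwards [hinj] with t ht
    refine propext ⟨fun h => ?_, fun h => ?_⟩
    · obtain ⟨ρ, hρ⟩ := Set.mem_iUnion.1 h
      exact fun i _ => ((hmem ρ t).1 hρ).2 i
    · obtain ⟨ρ, hρ⟩ := exists_perm_strictAnti (t := t)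
        (fun a b hab => by_contra fun hne => ht a b hne hab)
      exact Set.mem_iUnion.2 ⟨ρ, (hmem ρ t).2 ⟨hρ, fun i => h i (Set.mem_univ i)⟩⟩
  · intro ρ σ hne
    refine Set.disjoint_left.2 fun t h1 h2 => hne ?_
    exact perm_eq_of_strictAnti ((hmem ρ t).1 h1).1 ((hmem σ t).1 h2).1

/-- Both tuples sort to the same list; compose one sorting permutation with the inverse of the
other. -/
theorem exists_perm_of_map_univ_eq {r : ℕ} {κ κ' : Fin r → ℕ}
    (h : (List.ofFn κ : Multiset ℕ) = (List.ofFn κ' : Multiset ℕ)) :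
    ∃ ρ : Equiv.Perm (Fin r), κ' ∘ ρ = κ := by
  have h1 : List.ofFn (κ ∘ Tuple.sort κ) = List.ofFn (κ' ∘ Tuple.sort κ') := by
    refine List.Perm.eq_of_sortedLE (Tuple.monotone_sort κ).sortedLE_ofFn
      (Tuple.monotone_sort κ').sortedLE_ofFn ?_
    exact (Equiv.Perm.ofFn_comp_perm _ _).trans
      ((Multiset.coe_eq_coe.1 h).trans (Equiv.Perm.ofFn_comp_perm _ _).symm)
  have h2 := List.ofFn_injective h1
  refine ⟨(Tuple.sort κ).symm.trans (Tuple.sort κ'), funext fun i => ?_⟩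
  have := congrFun h2 ((Tuple.sort κ).symm i)
  simpa using this.symm

/-- Each rearrangement of a tuple comes from `∏ a_j!` permutations. -/
theorem card_perm_comp_eq {r : ℕ} (κ : Fin r → ℕ) (ρ : Equiv.Perm (Fin r)) :
    (Finset.univ.filter fun σ : Equiv.Perm (Fin r) => κ ∘ σ = κ ∘ ρ).card
      = ∏ j ∈ Finset.univ.image κ, ((List.ofFn κ).count j).factorial := by
  -- The permutations giving the same rearrangement as `ρ` form a coset of the stabilizer of `κ`,
  -- matched with it by `σ ↦ σ * ρ⁻¹`.
  have h1 := DomMulAct.stabilizer_card' κ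
  have h2 : ∀ j, Fintype.card {a // κ a = j} = (List.ofFn κ).count j := by
    intro j
    rw [← Multiset.coe_count, ← Fin.univ_val_map, Multiset.count_map, Fintype.card_subtype,
      Finset.card_def, Finset.filter_val]
    simp only [eq_comm]
  simp only [h2] at h1
  rw [← h1, Fintype.card_subtype]
  refine Finset.card_bij (fun σ _ => σ * ρ⁻¹) ?_ ?_ ?_
  · intro σ hσ
    simp only [Finset.mem_filter, Finset.mem_univ, true_and] at hσ ⊢
    funext i
    have := congrFun hσ (ρ⁻¹ i)
    simpa using this
  · intro σ _ τ _ h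
    exact mul_right_cancel h
  · intro σ hσ
    refine ⟨σ * ρ, ?_, by simp⟩
    simp only [Finset.mem_filter, Finset.mem_univ, true_and] at hσ ⊢
    funext i
    exact congrFun hσ (ρ i)

/-- The probability that independent variables of laws `ν k`, `k` in the list, are decreasing with
values in `A`. -/
noncomputable def orderedMass (ν : ℕ → Measure ℝ) (A : Set ℝ) (L : List ℕ) : ENNReal :=
  Measure.pi (fun i => ν (L.get i)) (decreasingTuples L.length A)

/-- The length of `List.ofFn κ` equals `r` only propositionally, so the equality is transported
through pairs of a length and a tuple. -/
theorem orderedMass_ofFn (ν : ℕ → Measure ℝ) (A : Set ℝ) {r : ℕ} (κ : Fin r → ℕ) :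
    orderedMass ν A (List.ofFn κ) = Measure.pi (fun i => ν (κ i)) (decreasingTuples r A) := by
  have h := (List.equivSigmaTuple (α := ℕ)).right_inv ⟨r, κ⟩
  exact congrArg (fun p : Σ r, Fin r → ℕ =>
    Measure.pi (fun i => ν (p.2 i)) (decreasingTuples p.1 A)) h

/-- Group the sum over all permutations by the list each produces: every arrangement of `s` occurs,
and each fibre has `∏ a_j!` elements. -/
theorem sum_orderedMass_arrangements (ν : ℕ → Measure ℝ) [∀ i, IsFiniteMeasure (ν i)]
    {A : Set ℝ} (hA : MeasurableSet A) (s : Multiset ℕ) (hν : ∀ k ∈ s, NullSingletonClass (ν k))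
    {F : Finset (List ℕ)} (hF : ∀ L, L ∈ F ↔ (L : Multiset ℕ) = s) :
    ((∏ j ∈ s.toFinset, (s.count j).factorial : ℕ) : ENNReal)
      * ∑ L ∈ F, orderedMass ν A L = (s.map fun k => ν k A).prod := by
  obtain ⟨r, κ, hκ⟩ : ∃ (r : ℕ) (κ : Fin r → ℕ), (List.ofFn κ : Multiset ℕ) = s :=
    ⟨_, s.toList.get, by rw [List.ofFn_get, Multiset.coe_toList]⟩
  have hκs : ∀ i, κ i ∈ s := fun i => by
    rw [← hκ, Multiset.mem_coe, List.mem_ofFn]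
    exact ⟨i, rfl⟩
  have : ∀ i, NullSingletonClass (ν (κ i)) := fun i => hν _ (hκs i)
  have h1 := sum_perm_decreasingTuples (fun i => ν (κ i)) hA
  have h2 : (s.map fun k => ν k A).prod = ∏ i, ν (κ i) A := by
    rw [← hκ, Multiset.map_coe, Multiset.prod_coe, List.map_ofFn, List.prod_ofFn]
    rfl
  rw [h2, ← h1]
  have h3 : ∀ ρ : Equiv.Perm (Fin r), Measure.pi (fun i => ν (κ (ρ i))) (decreasingTuples r A)
      = orderedMass ν A (List.ofFn (κ ∘ ρ)) := fun ρ => (orderedMass_ofFn ν A (κ ∘ ρ)).symm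
  simp only [h3]
  have h4 : ∀ ρ ∈ (Finset.univ : Finset (Equiv.Perm (Fin r))),
      List.ofFn (κ ∘ ρ) ∈ F := by
    intro ρ _
    rw [hF, ← hκ]
    exact Multiset.coe_eq_coe.2 (Equiv.Perm.ofFn_comp_perm ρ κ)
  rw [← Finset.sum_fiberwise_of_maps_to h4, Finset.mul_sum]
  refine Finset.sum_congr rfl fun L hL => ?_
  rw [hF] at hL
  have hlen : L.length = r := by
    have := congrArg Multiset.card (hκ.trans hL.symm)
    simpa using this.symm
  obtain ⟨κ', rfl⟩ : ∃ κ' : Fin r → ℕ, List.ofFn κ' = L := by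
    subst hlen
    exact ⟨L.get, List.ofFn_get L⟩
  obtain ⟨ρ, rfl⟩ := exists_perm_of_map_univ_eq (κ := κ') (κ' := κ) (hL.trans hκ.symm)
  rw [Finset.sum_congr rfl (g := fun _ => orderedMass ν A (List.ofFn (κ ∘ ρ)))
    fun σ hσ => by rw [(Finset.mem_filter.1 hσ).2], Finset.sum_const, nsmul_eq_mul]
  congr 2
  have h5 := card_perm_comp_eq κ ρ
  simp only [← List.ofFn_injective.eq_iff] at h5
  rw [h5, ← hκ]
  simp only [Multiset.coe_count]
  refine Finset.prod_congr ?_ fun _ _ => rfl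
  ext j
  simp [List.mem_ofFn]

/-! ### Ewens weights and their sum -/

/-- The unnormalised Ewens weight of a multiset of parts. -/
noncomputable def ewensWeight (θ : ℝ) (s : Multiset ℕ) : ℝ :=
  ∏ j ∈ s.toFinset, θ ^ s.count j / ((j : ℝ) ^ s.count j * ((s.count j).factorial : ℝ))

theorem ewensWeight_eq_prod (θ : ℝ) {s : Multiset ℕ} {F : Finset ℕ} (h : s.toFinset ⊆ F) :
    ewensWeight θ s
      = ∏ j ∈ F, θ ^ s.count j / ((j : ℝ) ^ s.count j * ((s.count j).factorial : ℝ)) := by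
  refine Finset.prod_subset h fun j _ hj => ?_
  rw [Multiset.mem_toFinset, ← Multiset.count_eq_zero] at hj
  simp [hj]

theorem ewensWeight_cons (θ : ℝ) (s : Multiset ℕ) {j : ℕ} (hj : 0 < j) :
    (j * (s.count j + 1) : ℝ) * ewensWeight θ (j ::ₘ s) = θ * ewensWeight θ s := by
  have hF : s.toFinset ⊆ insert j s.toFinset := Finset.subset_insert _ _
  have hF' : (j ::ₘ s).toFinset ⊆ insert j s.toFinset := by simp
  rw [ewensWeight_eq_prod θ hF, ewensWeight_eq_prod θ hF',
    ← Finset.mul_prod_erase _ _ (Finset.mem_insert_self j _),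
    ← Finset.mul_prod_erase (insert j s.toFinset) _ (Finset.mem_insert_self j _)]
  have h1 : ∀ i ∈ (insert j s.toFinset).erase j, (j ::ₘ s).count i = s.count i := fun i hi =>
    Multiset.count_cons_of_ne (Finset.ne_of_mem_erase hi) s
  rw [Finset.prod_congr rfl fun i hi => by rw [h1 i hi], Multiset.count_cons_self,
    Nat.factorial_succ]
  have hj' : (j : ℝ) ≠ 0 := by exact_mod_cast hj.ne'
  have h2 : ((s.count j).factorial : ℝ) ≠ 0 := by exact_mod_cast Nat.factorial_ne_zero _
  have h3 : (s.count j : ℝ) + 1 ≠ 0 := by positivity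
  push_cast
  field_simp
  ring

/-- Partitions without a part `j` contribute nothing on the left; the others arise uniquely by
adjoining `j` to a partition of `m - j`, and `ewensWeight_cons` compares the weights. -/
theorem sum_partition_count_mul (θ : ℝ) {m j : ℕ} (hj : 0 < j) (hjm : j ≤ m) :
    ∑ π : m.Partition, (j * π.parts.count j : ℝ) * ewensWeight θ π.parts
      = θ * ∑ π : (m - j).Partition, ewensWeight θ π.parts := by
  rw [Finset.mul_sum]
  symm
  let e : (m - j).Partition → m.Partition := fun π => ⟨j ::ₘ π.parts, by
    intro i hi
    rcases Multiset.mem_cons.1 hi with rfl | hi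
    · exact hj
    · exact π.parts_pos hi, by rw [Multiset.sum_cons, π.parts_sum]; omega⟩
  refine Finset.sum_of_injOn e ?_ (fun _ _ => Finset.mem_coe.2 (Finset.mem_univ _)) ?_ ?_
  · intro π _ π' _ h
    exact Nat.Partition.ext ((Multiset.cons_inj_right j).1 (congrArg Nat.Partition.parts h))
  · intro π _ hπ
    have : j ∉ π.parts := by
      intro hmem
      refine hπ ⟨⟨π.parts.erase j, fun hi => π.parts_pos (Multiset.mem_of_mem_erase hi), ?_⟩,
        by simp, Nat.Partition.ext (Multiset.cons_erase hmem)⟩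
      have h := Multiset.sum_erase hmem
      rw [π.parts_sum] at h
      omega
    simp [Multiset.count_eq_zero.2 this]
  · intro π _
    have h := ewensWeight_cons θ π.parts hj
    simp only [e, Multiset.count_cons_self]
    rw [← h]
    push_cast
    ring

theorem mul_sum_ewensWeight (θ : ℝ) (m : ℕ) :
    (m : ℝ) * ∑ π : m.Partition, ewensWeight θ π.parts
      = θ * ∑ i ∈ Finset.range m, ∑ π : i.Partition, ewensWeight θ π.parts := by
  -- Writing `m` as the sum of `j * a_j` allows one part to be removed for each `j`.
  have h1 : ∀ π : m.Partition, (m : ℝ) = ∑ j ∈ Finset.Icc 1 m, (j * π.parts.count j : ℝ) := by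
    intro π
    have h := Finset.sum_multiset_count π.parts
    rw [Finset.sum_subset (s₂ := Finset.Icc 1 m), π.parts_sum] at h
    · conv_lhs => rw [h]
      push_cast
      exact Finset.sum_congr rfl fun j _ => by simp [mul_comm]
    · intro j hj
      rw [Multiset.mem_toFinset] at hj
      exact Finset.mem_Icc.2 ⟨π.parts_pos hj, π.le_of_mem_parts hj⟩
    · intro j _ hj
      rw [Multiset.mem_toFinset, ← Multiset.count_eq_zero] at hj
      simp [hj]
  rw [Finset.mul_sum, Finset.sum_congr rfl fun π _ => by rw [h1 π, Finset.sum_mul],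
    Finset.sum_comm, Finset.mul_sum, ← Finset.sum_range_reflect]
  -- The range has been reflected, so index `j - 1` carries the partitions of `m - 1 - (j - 1) = m -
  -- j`.
  refine Finset.sum_bij (fun j _ => j - 1) ?_ ?_ ?_ ?_
  · intro j hj
    rw [Finset.mem_Icc] at hj
    rw [Finset.mem_range]
    omega
  · intro i hi j hj h
    rw [Finset.mem_Icc] at hi hj
    omega
  · intro i hi
    rw [Finset.mem_range] at hi
    exact ⟨i + 1, by rw [Finset.mem_Icc]; omega, by omega⟩
  · intro j hj
    rw [Finset.mem_Icc] at hj
    rw [sum_partition_count_mul θ hj.1 hj.2]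
    have : m - 1 - (j - 1) = m - j := by omega
    rw [this]

/-- With `W m` the sum, peeling the last term off `mul_sum_ewensWeight` gives `(m + 1) * W (m + 1) =
(m + θ) * W m`. No sign condition on `θ` is needed. -/
theorem sum_ewensWeight (θ : ℝ) (m : ℕ) :
    ∑ π : m.Partition, ewensWeight θ π.parts = (∏ i ∈ Finset.range m, (θ + i)) / m.factorial := by
  induction m with
  | zero => simp [ewensWeight]
  | succ m ih =>
    have h1 := mul_sum_ewensWeight θ (m + 1)
    rw [Finset.sum_range_succ, mul_add, ← mul_sum_ewensWeight, ih] at h1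
    rw [Finset.prod_range_succ, Nat.factorial_succ]
    have h2 : (m.factorial : ℝ) ≠ 0 := by exact_mod_cast Nat.factorial_ne_zero _
    have h3 : (m : ℝ) + 1 ≠ 0 := by positivity
    push_cast at h1 ⊢
    rw [← mul_right_inj' h3, h1]
    field_simp
    ring

theorem ewensFormula_eq_div (θ : ℝ) {m : ℕ} (π : m.Partition) :
    ewensFormula θ π = ewensWeight θ π.parts / ∑ π' : m.Partition, ewensWeight θ π'.parts := by
  rw [sum_ewensWeight, ewensFormula, ewensWeight_eq_prod θ (F := Finset.Icc 1 m), div_div_eq_mul_div,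
    div_mul_eq_mul_div, mul_comm]
  intro j hj
  rw [Multiset.mem_toFinset] at hj
  exact Finset.mem_Icc.2 ⟨π.parts_pos hj, π.le_of_mem_parts hj⟩

/-! ### Face events grouped by partition -/

/-- The probability that the faces have slopes in `A` and lengths the parts of `π`. -/
theorem sum_faceEvent_of_partition (μ : Measure ℝ) [IsProbabilityMeasure μ] [NullSingletonClass μ]
    {m : ℕ} {A : Set ℝ} (hA : MeasurableSet A) {θ : ℝ}
    (hθ : ∀ k, 1 ≤ k → k ≤ m → (Measure.pi fun _ : Fin k => μ).real {y | chordSlope y ∈ A} = θ)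
    (π : m.Partition) :
    ∑ c : Composition m with Nat.Partition.ofComposition m c = π,
      (Measure.pi fun _ : Fin m => μ).real (FaceEvent c A) = ewensWeight θ π.parts := by
  let C : Finset (Composition m) := {c | Nat.Partition.ofComposition m c = π}
  have hC : ∀ c, c ∈ C ↔ (c.blocks : Multiset ℕ) = π.parts := fun c => by
    simp only [C, Finset.mem_filter, Finset.mem_univ, true_and, Nat.Partition.ext_iff]
    rfl
  have hF : ∀ L : List ℕ, L ∈ C.image Composition.blocks ↔ (L : Multiset ℕ) = π.parts := by
    intro L
    simp only [Finset.mem_image, hC]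
    constructor
    · rintro ⟨c, hc, rfl⟩
      exact hc
    · intro h
      refine ⟨⟨L, fun hi => π.parts_pos (by rw [← h]; exact hi), ?_⟩, h, rfl⟩
      rw [← Multiset.sum_coe, h, π.parts_sum]
  have h1 := sum_orderedMass_arrangements (faceLaw μ) hA π.parts
    (fun k hk => nullSingletonClass_faceLaw μ (π.parts_pos hk)) hF
  rw [Finset.sum_image fun c _ c' _ h => Composition.ext h] at h1
  have h2 : ∀ c : Composition m, orderedMass (faceLaw μ) A c.blocks
      = Measure.pi (fun _ : Fin m => μ) (FaceEvent c A) := fun c => (pi_faceEvent μ c hA).symm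
  simp only [h2] at h1
  have h3 := congrArg ENNReal.toReal h1
  rw [ENNReal.toReal_mul, ENNReal.toReal_natCast,
    ENNReal.toReal_sum fun c _ => measure_ne_top _ _, Finset.prod_multiset_map_count,
    ENNReal.toReal_prod] at h3
  -- The cyclic lemma gives each part `k` the mass `θ / k`.
  have h4 : ∀ k ∈ π.parts.toFinset, (faceLaw μ k A ^ π.parts.count k).toReal
      = θ ^ π.parts.count k / (k : ℝ) ^ π.parts.count k := by
    intro k hk
    rw [Multiset.mem_toFinset] at hk
    have hk0 := π.parts_pos hk
    have h := congrArg ENNReal.toReal (pi_belowChord hk0 μ hA)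
    rw [← faceLaw_apply μ k hA, ENNReal.toReal_mul, ENNReal.toReal_natCast] at h
    have hk' : (k : ℝ) ≠ 0 := by exact_mod_cast hk0.ne'
    rw [ENNReal.toReal_pow, ← div_pow, eq_div_of_mul_eq hk' ((mul_comm _ _).trans h)]
    congr 2
    exact hθ k hk0 (π.le_of_mem_parts hk)
  rw [Finset.prod_congr rfl h4] at h3
  have h5 : ((∏ j ∈ π.parts.toFinset, (π.parts.count j).factorial : ℕ) : ℝ) ≠ 0 := by
    exact_mod_cast Finset.prod_ne_zero_iff.2 fun j _ => Nat.factorial_ne_zero _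
  refine mul_left_cancel₀ h5 (h3.trans ?_)
  rw [ewensWeight, Nat.cast_prod, ← Finset.prod_mul_distrib]
  refine Finset.prod_congr rfl fun j hj => ?_
  have h6 : ((π.parts.count j).factorial : ℝ) ≠ 0 := by exact_mod_cast Nat.factorial_ne_zero _
  have h7 : (j : ℝ) ≠ 0 := by
    exact_mod_cast (π.parts_pos (Multiset.mem_toFinset.1 hj)).ne'
  field_simp

theorem sum_faceEvent (μ : Measure ℝ) [IsProbabilityMeasure μ] [NullSingletonClass μ]
    {m : ℕ} {A : Set ℝ} (hA : MeasurableSet A) {θ : ℝ}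
    (hθ : ∀ k, 1 ≤ k → k ≤ m → (Measure.pi fun _ : Fin k => μ).real {y | chordSlope y ∈ A} = θ) :
    ∑ c : Composition m, (Measure.pi fun _ : Fin m => μ).real (FaceEvent c A)
      = ∑ π : m.Partition, ewensWeight θ π.parts := by
  rw [← Finset.sum_fiberwise (g := Nat.Partition.ofComposition m)]
  exact Finset.sum_congr rfl fun π _ => sum_faceEvent_of_partition μ hA hθ π

/-! ### Contact times: tangents and chords -/

/-- An affine function is concave, so a line above the points and through `(k, s k)` bounds the
majorant there. -/
theorem mem_contactTimes_of_tangent {n k : ℕ} {s : ℕ → ℝ} (hk : k ≤ n) {a : ℝ}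
    (h : ∀ j ≤ n, s j ≤ s k + a * ((j : ℝ) - k)) : k ∈ contactTimes n s := by
  classical
  refine Finset.mem_filter.2 ⟨Finset.mem_range.2 (by omega), le_antisymm ?_ ?_⟩
  · exact (concaveMajorant_isConcaveBound n s).2 k hk
  · have hC : IsConcaveBound n s fun y => s k + a * (y - k) := by
      refine ⟨⟨convex_Icc _ _, fun x _ y _ b c _ _ hbc => le_of_eq ?_⟩, h⟩
      simp only [smul_eq_mul]
      linear_combination (s k - a * k) * hbc
    have := concaveMajorant_le hC (x := k) ⟨by positivity, by exact_mod_cast hk⟩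
    simpa using this

/-- Concavity forces the majorant above the chord from `i` to `j`. The chord inequality is
multiplied through by `j - i` to avoid division. -/
theorem notMem_contactTimes_of_lt_chord {n i k j : ℕ} {s : ℕ → ℝ} (hik : i < k) (hkj : k < j)
    (hj : j ≤ n) (h : s k * ((j : ℝ) - i) < s i * ((j : ℝ) - k) + s j * ((k : ℝ) - i)) :
    k ∉ contactTimes n s := by
  classical
  intro hmem
  have heq : s k = concaveMajorant n s k := (Finset.mem_filter.1 hmem).2
  obtain ⟨hC, hle⟩ := concaveMajorant_isConcaveBound n s
  have hik' : (i : ℝ) < k := by exact_mod_cast hik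
  have hkj' : (k : ℝ) < j := by exact_mod_cast hkj
  have hjn : (j : ℝ) ≤ n := by exact_mod_cast hj
  have hi0 : (0 : ℝ) ≤ i := by positivity
  have hd : (0 : ℝ) < j - i := by linarith
  have h1 := hC.2 (⟨hi0, by linarith⟩ : (i : ℝ) ∈ Set.Icc 0 (n : ℝ))
    (⟨by linarith, hjn⟩ : (j : ℝ) ∈ Set.Icc 0 (n : ℝ))
    (div_nonneg (by linarith) hd.le : 0 ≤ ((j : ℝ) - k) / (j - i))
    (div_nonneg (by linarith) hd.le : 0 ≤ ((k : ℝ) - i) / (j - i)) (by field_simp; ring)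
  have h2 : ((j : ℝ) - k) / (j - i) * i + (k - i) / (j - i) * j = k := by
    field_simp
    ring
  simp only [smul_eq_mul] at h1
  rw [h2, ← heq] at h1
  have h3 := mul_le_mul_of_nonneg_right h1 hd.le
  have h4 : (((j : ℝ) - k) / (j - i) * concaveMajorant n s i
      + (k - i) / (j - i) * concaveMajorant n s j) * (j - i)
      = (j - k) * concaveMajorant n s i + (k - i) * concaveMajorant n s j := by
    field_simp
  rw [h4] at h3
  have h5 := mul_le_mul_of_nonneg_left (hle i (by omega)) (by linarith : (0 : ℝ) ≤ j - k)
  have h6 := mul_le_mul_of_nonneg_left (hle j hj) (by linarith : (0 : ℝ) ≤ k - i)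
  linarith

theorem argmaxTime_eq_iff {n l : ℕ} {s : ℕ → ℝ} :
    argmaxTime n s = l ↔ l ≤ n ∧ (∀ j ≤ n, s j ≤ s l) ∧ ∀ j < l, s j < s l := by
  have hne : {k | k ≤ n ∧ ∀ j ≤ n, s j ≤ s k}.Nonempty := by
    obtain ⟨k, hk, hmax⟩ := Finset.exists_max_image (Finset.range (n + 1)) s ⟨0, by simp⟩
    exact ⟨k, by simpa [Nat.lt_succ_iff] using hk, fun j hj => hmax j (by simpa using by omega)⟩
  constructor
  · rintro rfl
    have h := Nat.sInf_mem hne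
    refine ⟨h.1, h.2, fun j hj => ?_⟩
    by_contra! hle
    have hj' : j < sInf {k | k ≤ n ∧ ∀ j ≤ n, s j ≤ s k} := hj
    exact Nat.notMem_of_lt_sInf hj'
      ⟨hj'.le.trans h.1, fun i hi => (h.2 i hi).trans hle⟩
  · rintro ⟨hl, hmax, hlt⟩
    refine le_antisymm (Nat.sInf_le ⟨hl, hmax⟩) ?_
    by_contra! h
    exact (hlt _ h).not_ge ((Nat.sInf_mem hne).2 l hl)

/-! ### Compositions and the contact times of a walk -/

/-- `k` is an end point of a block of `c`. -/
def IsBoundary {m : ℕ} (c : Composition m) (k : ℕ) : Prop := ∃ i ≤ c.length, c.sizeUpTo i = k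

theorem isBoundary_zero {m : ℕ} (c : Composition m) : IsBoundary c 0 :=
  ⟨0, Nat.zero_le _, c.sizeUpTo_zero⟩

theorem isBoundary_self {m : ℕ} (c : Composition m) : IsBoundary c m :=
  ⟨_, le_rfl, c.sizeUpTo_length⟩

theorem sizeUpTo_lt_sizeUpTo_iff {m : ℕ} (c : Composition m) {i j : ℕ} (hi : i ≤ c.length)
    (hj : j ≤ c.length) : c.sizeUpTo i < c.sizeUpTo j ↔ i < j := by
  have := (c.boundary).lt_iff_lt (a := ⟨i, by omega⟩) (b := ⟨j, by omega⟩)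
  simpa [Composition.boundary, Fin.lt_def] using this

theorem composition_eq_of_isBoundary_iff {m : ℕ} {c c' : Composition m}
    (h : ∀ k ≤ m, IsBoundary c k ↔ IsBoundary c' k) : c = c' := by
  have key : ∀ (c : Composition m) (k : Fin (m + 1)), k ∈ c.boundaries ↔ IsBoundary c k := by
    intro c k
    simp only [Composition.boundaries, Finset.mem_map, Finset.mem_univ, true_and, IsBoundary]
    constructor
    · rintro ⟨i, rfl⟩
      exact ⟨i, by omega, rfl⟩
    · rintro ⟨i, hi, h⟩
      exact ⟨⟨i, by omega⟩, Fin.ext h⟩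
  refine (compositionEquiv m).injective (CompositionAsSet.ext ?_)
  ext k
  exact (key c k).trans ((h k (by omega)).trans (key c' k).symm)

theorem isBoundary_or_mem_block {m : ℕ} (c : Composition m) {k : ℕ} (hk : k ≤ m) :
    IsBoundary c k ∨ ∃ (i : Fin c.length) (j : ℕ), 0 < j ∧ j < c.blocksFun i ∧
      k = c.sizeUpTo i + j := by
  rcases hk.lt_or_eq with hk | rfl
  · have h1 := c.sizeUpTo_index_le ⟨k, hk⟩
    have h2 := c.lt_sizeUpTo_index_succ ⟨k, hk⟩
    simp only [Fin.val_succ] at h1 h2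
    rw [c.sizeUpTo_succ'] at h2
    rcases h1.eq_or_lt with h | h
    · exact .inl ⟨_, (c.index ⟨k, hk⟩).2.le, h⟩
    · exact .inr ⟨c.index ⟨k, hk⟩, k - c.sizeUpTo (c.index ⟨k, hk⟩), by omega, by omega, by omega⟩
  · exact .inl (isBoundary_self c)

theorem walk_add_block {m : ℕ} (c : Composition m) (x : Fin m → ℝ) (i : Fin c.length) {j : ℕ}
    (hj : j ≤ c.blocksFun i) :
    walk x (c.sizeUpTo i + j) = walk x (c.sizeUpTo i) + walk (x ∘ c.embedding i) j := by
  induction j with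
  | zero => simp [walk_zero]
  | succ j ih =>
    have h1 := c.sizeUpTo_succ' i
    have h2 := c.sizeUpTo_le (i + 1)
    rw [← add_assoc, walk_succ x _ (by omega), walk_succ _ j (by omega), ih (by omega), add_assoc]
    rfl

theorem chordSlope_mul {k : ℕ} (y : Fin k → ℝ) : k * chordSlope y = walk y k := by
  rcases Nat.eq_zero_or_pos k with rfl | hk
  · simp [walk]
  · have : (k : ℝ) ≠ 0 := by exact_mod_cast hk.ne'
    rw [chordSlope]
    field_simp

theorem walk_sizeUpTo_succ {m : ℕ} (c : Composition m) (x : Fin m → ℝ) (i : Fin c.length) :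
    walk x (c.sizeUpTo (i + 1))
      = walk x (c.sizeUpTo i) + c.blocksFun i * chordSlope (x ∘ c.embedding i) := by
  rw [c.sizeUpTo_succ', walk_add_block c x i le_rfl, chordSlope_mul]

/-- The slope, at each time step, of the chords over the blocks of `c`. -/
noncomputable def blockSlopes {m : ℕ} (c : Composition m) (x : Fin m → ℝ) (j : Fin m) : ℝ :=
  chordSlope (x ∘ c.embedding (c.index j))

theorem walk_blockSlopes_add {m : ℕ} (c : Composition m) (x : Fin m → ℝ) (i : Fin c.length) {j : ℕ}
    (hj : j ≤ c.blocksFun i) :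
    walk (blockSlopes c x) (c.sizeUpTo i + j)
      = walk (blockSlopes c x) (c.sizeUpTo i) + j * chordSlope (x ∘ c.embedding i) := by
  rw [walk_add_block c _ i hj]
  have h : blockSlopes c x ∘ c.embedding i = fun _ => chordSlope (x ∘ c.embedding i) := by
    funext j
    have h : ∀ i', i' = i → chordSlope (x ∘ c.embedding i') = chordSlope (x ∘ c.embedding i) := by
      rintro _ rfl
      rfl
    exact h _ (c.index_embedding i j)
  rw [h]
  congr 1
  clear h
  induction j with
  | zero => simp [walk_zero]
  | succ j ih =>
    rw [walk_succ _ j (by omega), ih (by omega)]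
    push_cast
    ring

/-- The walk with increments `blockSlopes c x` is the piecewise linear candidate for the majorant;
it agrees with the original walk at block ends. -/
theorem walk_blockSlopes_eq {m : ℕ} (c : Composition m) (x : Fin m → ℝ) {k : ℕ}
    (hk : IsBoundary c k) : walk (blockSlopes c x) k = walk x k := by
  obtain ⟨i, hi, rfl⟩ := hk
  induction i with
  | zero => simp [walk_zero]
  | succ i ih =>
    have h1 := walk_sizeUpTo_succ c x ⟨i, hi⟩
    have h2 := walk_blockSlopes_add c x ⟨i, hi⟩ le_rfl
    rw [← c.sizeUpTo_succ'] at h2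
    exact h2.trans (by rw [ih (by omega)]; exact h1.symm)

theorem blockSlopes_antitone {m : ℕ} (c : Composition m) (x : Fin m → ℝ)
    (h : StrictAnti fun i => chordSlope (x ∘ c.embedding i)) : Antitone (blockSlopes c x) := by
  intro a b hab
  refine h.antitone (?_ : c.index a ≤ c.index b)
  by_contra! hlt
  have h1 := c.lt_sizeUpTo_index_succ b
  have h2 := c.sizeUpTo_index_le a
  have h3 : c.sizeUpTo (c.index b).succ ≤ c.sizeUpTo (c.index a) := c.monotone_sizeUpTo hlt
  have h4 : (a : ℕ) ≤ b := hab
  omega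

/-- Any increment adjacent to `k` is a supergradient: later increments are no larger and earlier
ones no smaller. The step after `k` serves, or the step before it when `k = m`. -/
theorem exists_tangent_of_antitone {m : ℕ} {g : Fin m → ℝ} (hg : Antitone g) (hm : 0 < m) {k : ℕ}
    (hk : k ≤ m) : ∃ i, ∀ j ≤ m, walk g j ≤ walk g k + g i * ((j : ℝ) - k) := by
  obtain ⟨i, hi1, hi2⟩ : ∃ i : Fin m, (i : ℕ) ≤ k ∧ k ≤ i + 1 := by
    rcases hk.lt_or_eq with hk | rfl
    · exact ⟨⟨k, hk⟩, le_rfl, Nat.le_succ k⟩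
    · exact ⟨⟨k - 1, by omega⟩, Nat.sub_le k 1, by simp only; omega⟩
  refine ⟨i, fun j hj => ?_⟩
  rcases le_total k j with h | h
  · induction j, h using Nat.le_induction with
    | base => simp
    | succ j hkj ih =>
      have h1 := ih (by omega)
      have h2 : g ⟨j, hj⟩ ≤ g i := hg (Fin.le_def.2 (hi1.trans hkj))
      rw [walk_succ g j hj]
      push_cast
      linarith
  · induction h using Nat.decreasingInduction with
    | self => simp
    | of_succ j hjk ih =>
      have h1 := ih (by omega)
      have h2 : g i ≤ g ⟨j, by omega⟩ := hg (Fin.le_def.2 (by simp only; omega))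
      rw [walk_succ g j (by omega)] at h1
      push_cast at h1
      linarith

theorem walk_le_blockSlopes {m : ℕ} {c : Composition m} {x : Fin m → ℝ} {A : Set ℝ}
    (hx : x ∈ FaceEvent c A) {k : ℕ} (hk : k ≤ m) : walk x k ≤ walk (blockSlopes c x) k := by
  rcases isBoundary_or_mem_block c hk with h | ⟨i, j, hj0, hj, rfl⟩
  · exact (walk_blockSlopes_eq c x h).ge
  · rw [walk_blockSlopes_add c x i hj.le, walk_blockSlopes_eq c x ⟨i, i.2.le, rfl⟩,
      walk_add_block c x i hj.le]
    have h1 := hx.1 i j hj0 hj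
    have h2 : (0 : ℝ) < c.blocksFun i := by exact_mod_cast hj0.trans hj
    rw [← chordSlope_mul] at h1
    have h3 : walk (x ∘ c.embedding i) j < j * chordSlope (x ∘ c.embedding i) := by
      refine lt_of_mul_lt_mul_right ?_ h2.le
      linarith
    linarith

/-- The slope is kept in `A` because its sign is needed when two walks are joined. For `m = 0` there
is no block to supply it, and slope `0` is used. -/
theorem exists_tangent_of_isBoundary {m : ℕ} {c : Composition m} {x : Fin m → ℝ} {A : Set ℝ}
    (hx : x ∈ FaceEvent c A) {k : ℕ} (hkm : k ≤ m) (hk : IsBoundary c k) :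
    ∃ a, (m = 0 ∧ a = 0 ∨ a ∈ A) ∧ ∀ j ≤ m, walk x j ≤ walk x k + a * ((j : ℝ) - k) := by
  rcases Nat.eq_zero_or_pos m with rfl | hm
  · refine ⟨0, .inl ⟨rfl, rfl⟩, fun j hj => ?_⟩
    obtain rfl : j = 0 := by omega
    obtain rfl : k = 0 := by omega
    simp
  · obtain ⟨i, hi⟩ := exists_tangent_of_antitone (blockSlopes_antitone c x hx.2.1) hm hkm
    refine ⟨blockSlopes c x i, .inr (hx.2.2 _), fun j hj => ?_⟩
    rw [← walk_blockSlopes_eq c x hk]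
    exact (walk_le_blockSlopes hx hj).trans (hi j hj)

theorem exists_lt_chord_of_not_isBoundary {m : ℕ} {c : Composition m} {x : Fin m → ℝ} {A : Set ℝ}
    (hx : x ∈ FaceEvent c A) {k : ℕ} (hkm : k ≤ m) (hk : ¬ IsBoundary c k) :
    ∃ i j, i < k ∧ k < j ∧ j ≤ m ∧
      walk x k * ((j : ℝ) - i) < walk x i * ((j : ℝ) - k) + walk x j * ((k : ℝ) - i) := by
  rcases isBoundary_or_mem_block c hkm with h | ⟨i, j, hj0, hj, rfl⟩
  · exact absurd h hk
  · have h0 := c.sizeUpTo_le (i + 1)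
    rw [c.sizeUpTo_succ'] at h0
    refine ⟨c.sizeUpTo i, c.sizeUpTo i + c.blocksFun i, by omega, by omega, h0, ?_⟩
    rw [walk_add_block c x i hj.le, walk_add_block c x i le_rfl]
    have h1 := hx.1 i j hj0 hj
    push_cast
    linear_combination h1

theorem mem_contactTimes_walk_iff {m : ℕ} {c : Composition m} {x : Fin m → ℝ} {A : Set ℝ}
    (hx : x ∈ FaceEvent c A) {k : ℕ} (hkm : k ≤ m) :
    k ∈ contactTimes m (walk x) ↔ IsBoundary c k := by
  refine ⟨fun h => ?_, fun h => ?_⟩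
  · by_contra hk
    obtain ⟨i, j, hik, hkj, hj, hlt⟩ := exists_lt_chord_of_not_isBoundary hx hkm hk
    exact notMem_contactTimes_of_lt_chord hik hkj hj hlt h
  · obtain ⟨a, -, ha⟩ := exists_tangent_of_isBoundary hx hkm h
    exact mem_contactTimes_of_tangent hkm ha

/-- The walk determines its contact times, hence the block ends, hence the composition. -/
theorem disjoint_faceEvent {m : ℕ} {c c' : Composition m} (h : c ≠ c') (A B : Set ℝ) :
    Disjoint (FaceEvent c A) (FaceEvent c' B) := by
  refine Set.disjoint_left.2 fun x hx hx' => h (composition_eq_of_isBoundary_iff fun k hk => ?_)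
  rw [← mem_contactTimes_walk_iff hx hk, mem_contactTimes_walk_iff hx' hk]

theorem faceLengthsOn_eq_blocks {n a b m : ℕ} {s : ℕ → ℝ} (hb : b = a + m) (c : Composition m)
    (h : ∀ k ≤ m, a + k ∈ contactTimes n s ↔ IsBoundary c k) :
    faceLengthsOn n s a b = (c.blocks : Multiset ℕ) := by
  classical
  subst hb
  have hmem : ∀ i ≤ c.length, a + c.sizeUpTo i ∈ contactTimes n s := fun i hi =>
    (h _ (c.sizeUpTo_le i)).2 ⟨i, hi, rfl⟩
  have hmem' : ∀ k ∈ contactTimes n s, a ≤ k → k ≤ a + m →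
      ∃ i ≤ c.length, k = a + c.sizeUpTo i := by
    intro k hk h1 h2
    obtain ⟨k, rfl⟩ := Nat.exists_eq_add_of_le h1
    obtain ⟨i, hi, hik⟩ := (h k (by omega)).1 hk
    exact ⟨i, hi, by rw [hik]⟩
  let f : Fin c.length ↪ ℕ × ℕ := ⟨fun i => (a + c.sizeUpTo i, a + c.sizeUpTo (i + 1)), by
    intro i j hij
    have h1 := congrArg Prod.fst hij
    simp only at h1
    by_contra hne
    rcases lt_or_gt_of_ne hne with h' | h'
    · have := (sizeUpTo_lt_sizeUpTo_iff c i.2.le j.2.le).2 h'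
      omega
    · have := (sizeUpTo_lt_sizeUpTo_iff c j.2.le i.2.le).2 h'
      omega⟩
  have hfaces : {e ∈ majorantFaces n s | a ≤ e.1 ∧ e.2 ≤ a + m} = Finset.univ.map f := by
    ext ⟨p, q⟩
    simp only [majorantFaces, Finset.mem_filter, Finset.mem_product, Finset.mem_map,
      Finset.mem_univ, true_and]
    constructor
    · rintro ⟨⟨⟨hp, hq⟩, hpq, hbt⟩, hap, hqm⟩
      obtain ⟨i, hi, rfl⟩ := hmem' p hp hap (by omega)
      obtain ⟨j, hj, rfl⟩ := hmem' q hq (by omega) hqm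
      have hij := (sizeUpTo_lt_sizeUpTo_iff c hi hj).1 (by omega)
      refine ⟨⟨i, by omega⟩, ?_⟩
      obtain hj' | hj' : j = i + 1 ∨ i + 1 < j := by omega
      · subst hj'
        rfl
      · refine absurd ⟨?_, ?_⟩ (hbt _ (hmem (i + 1) (by omega)))
        · have := (sizeUpTo_lt_sizeUpTo_iff c hi (j := i + 1) (by omega)).2 (by omega)
          omega
        · have := (sizeUpTo_lt_sizeUpTo_iff c (i := i + 1) (by omega) hj).2 hj'
          omega
    · rintro ⟨i, hi⟩
      obtain ⟨rfl, rfl⟩ := Prod.mk.inj hi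
      have hlt : c.sizeUpTo i < c.sizeUpTo (i + 1) :=
        (sizeUpTo_lt_sizeUpTo_iff c i.2.le i.2).2 (Nat.lt_succ_self i)
      have hle := c.sizeUpTo_le (i + 1)
      refine ⟨⟨⟨hmem _ i.2.le, hmem _ i.2⟩, by omega, fun k hk hbt => ?_⟩, by omega, by omega⟩
      obtain ⟨j, hj, rfl⟩ := hmem' k hk (by omega) (by omega)
      have h1 := (sizeUpTo_lt_sizeUpTo_iff c i.2.le hj).1 (by omega)
      have h2 : j < (i : ℕ) + 1 := (sizeUpTo_lt_sizeUpTo_iff c hj i.2).1 (by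
        rw [Nat.succ_eq_add_one]; omega)
      omega
  rw [faceLengthsOn, hfaces, Finset.map_val, Multiset.map_map, ← c.ofFn_blocksFun,
    ← Fin.univ_val_map]
  refine Multiset.map_congr rfl fun i _ => ?_
  have := c.sizeUpTo_succ' i
  change a + c.sizeUpTo (i + 1) - (a + c.sizeUpTo i) = c.blocksFun i
  omega

/-! ### Splitting the walk at its maximum -/

/-- `s` is a walk up to time `l` followed by a walk of `r` steps. -/
structure IsConcatWalk {l r : ℕ} (s : ℕ → ℝ) (u : Fin l → ℝ) (v : Fin r → ℝ) : Prop where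
  left : ∀ j ≤ l, s j = walk u j
  right : ∀ j ≤ r, s (l + j) = walk u l + walk v j

namespace IsConcatWalk

variable {l r : ℕ} {s : ℕ → ℝ} {u : Fin l → ℝ} {v : Fin r → ℝ} {c : Composition l}
  {d : Composition r}

/-- Beyond `l` the walk stays below the level `s l`, by a tangent of slope at most `0` to `v` at its
start, while the left tangent is nondecreasing; so it dominates globally. -/
theorem tangent_left (h : IsConcatWalk s u v) (hu : u ∈ FaceEvent c (Set.Ioi 0))
    (hv : v ∈ FaceEvent d (Set.Iic 0)) {k : ℕ} (hkl : k ≤ l) (hk : IsBoundary c k) :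
    ∃ a, (l = 0 ∧ a = 0 ∨ 0 < a) ∧ ∀ j ≤ l + r, s j ≤ s k + a * ((j : ℝ) - k) := by
  obtain ⟨a, ha, hle⟩ := exists_tangent_of_isBoundary hu hkl hk
  obtain ⟨b, hb, hle'⟩ := exists_tangent_of_isBoundary hv (Nat.zero_le r) (isBoundary_zero d)
  refine ⟨a, ha, fun j hj => ?_⟩
  rw [h.left k hkl]
  rcases le_total j l with hjl | hjl
  · rw [h.left j hjl]
    exact hle j hjl
  · obtain ⟨j, rfl⟩ := Nat.exists_eq_add_of_le hjl
    have h1 := hle l le_rfl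
    have h2 := hle' j (by omega)
    have ha0 : 0 ≤ a := by
      rcases ha with ⟨-, rfl⟩ | ha
      · exact le_rfl
      · exact le_of_lt ha
    have hb0 : b ≤ 0 := by
      rcases hb with ⟨-, rfl⟩ | hb
      · exact le_rfl
      · exact hb
    rw [h.right j (by omega)]
    rw [walk_zero] at h2
    have h3 := mul_nonneg ha0 (Nat.cast_nonneg (α := ℝ) j)
    have h4 := mul_nonpos_of_nonpos_of_nonneg hb0 (Nat.cast_nonneg (α := ℝ) j)
    push_cast at h2 ⊢
    linarith

theorem tangent_right (h : IsConcatWalk s u v) (hu : u ∈ FaceEvent c (Set.Ioi 0))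
    (hv : v ∈ FaceEvent d (Set.Iic 0)) {k : ℕ} (hkr : k ≤ r) (hk : IsBoundary d k) :
    ∃ a ≤ 0, ∀ j ≤ l + r, s j ≤ s (l + k) + a * ((j : ℝ) - (l + k : ℕ)) := by
  obtain ⟨b, hb, hle⟩ := exists_tangent_of_isBoundary hv hkr hk
  obtain ⟨a, ha, hle'⟩ := exists_tangent_of_isBoundary hu le_rfl (isBoundary_self c)
  have ha0 : 0 ≤ a := by
    rcases ha with ⟨-, rfl⟩ | ha
    · exact le_rfl
    · exact le_of_lt ha
  have hb0 : b ≤ 0 := by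
    rcases hb with ⟨-, rfl⟩ | hb
    · exact le_rfl
    · exact hb
  refine ⟨b, hb0, fun j hj => ?_⟩
  rw [h.right k hkr]
  rcases le_total l j with hjl | hjl
  · obtain ⟨j, rfl⟩ := Nat.exists_eq_add_of_le hjl
    rw [h.right j (by omega)]
    have h1 := hle j (by omega)
    push_cast
    linarith
  · have h1 := hle 0 (Nat.zero_le r)
    have h2 := hle' j hjl
    have hjl' : (j : ℝ) - l ≤ 0 := by
      rw [sub_nonpos]
      exact_mod_cast hjl
    rw [h.left j hjl]
    rw [walk_zero] at h1
    have h3 := mul_nonpos_of_nonneg_of_nonpos ha0 hjl'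
    have h4 := mul_nonneg_of_nonpos_of_nonpos hb0 hjl'
    push_cast at h1 ⊢
    linarith

theorem mem_contactTimes_left (h : IsConcatWalk s u v) (hu : u ∈ FaceEvent c (Set.Ioi 0))
    (hv : v ∈ FaceEvent d (Set.Iic 0)) {k : ℕ} (hkl : k ≤ l) :
    k ∈ contactTimes (l + r) s ↔ IsBoundary c k := by
  refine ⟨fun hmem => ?_, fun hk => ?_⟩
  · by_contra hk
    obtain ⟨i, j, hik, hkj, hj, hlt⟩ := exists_lt_chord_of_not_isBoundary hu hkl hk
    rw [← h.left k hkl, ← h.left i (by omega), ← h.left j hj] at hlt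
    exact notMem_contactTimes_of_lt_chord hik hkj (by omega) hlt hmem
  · obtain ⟨a, -, ha⟩ := h.tangent_left hu hv hkl hk
    exact mem_contactTimes_of_tangent (by omega) ha

theorem mem_contactTimes_right (h : IsConcatWalk s u v) (hu : u ∈ FaceEvent c (Set.Ioi 0))
    (hv : v ∈ FaceEvent d (Set.Iic 0)) {k : ℕ} (hkr : k ≤ r) :
    l + k ∈ contactTimes (l + r) s ↔ IsBoundary d k := by
  refine ⟨fun hmem => ?_, fun hk => ?_⟩
  · by_contra hk
    obtain ⟨i, j, hik, hkj, hj, hlt⟩ := exists_lt_chord_of_not_isBoundary hv hkr hk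
    refine notMem_contactTimes_of_lt_chord (i := l + i) (j := l + j) (by omega) (by omega)
      (by omega) ?_ hmem
    rw [h.right k hkr, h.right i (by omega), h.right j hj]
    push_cast
    linear_combination hlt
  · obtain ⟨a, -, ha⟩ := h.tangent_right hu hv hkr hk
    exact mem_contactTimes_of_tangent (by omega) ha

theorem argmaxTime_eq (h : IsConcatWalk s u v) (hu : u ∈ FaceEvent c (Set.Ioi 0))
    (hv : v ∈ FaceEvent d (Set.Iic 0)) : argmaxTime (l + r) s = l := by
  obtain ⟨a, ha, hle⟩ := h.tangent_left hu hv le_rfl (isBoundary_self c)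
  obtain ⟨b, hb, hle'⟩ := h.tangent_right hu hv (Nat.zero_le r) (isBoundary_zero d)
  have hlt : ∀ j < l, s j < s l := by
    intro j hj
    rcases ha with ⟨rfl, -⟩ | ha
    · omega
    · have h1 := hle j (by omega)
      have h2 : (j : ℝ) - l < 0 := by
        rw [sub_neg]
        exact_mod_cast hj
      have h3 := mul_neg_of_pos_of_neg ha h2
      linarith
  refine argmaxTime_eq_iff.2 ⟨by omega, fun j hj => ?_, hlt⟩
  rcases lt_or_ge j l with hjl | hjl
  · exact (hlt j hjl).le
  · have h1 := hle' j hj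
    have h2 : (0 : ℝ) ≤ (j : ℝ) - l := by
      rw [sub_nonneg]
      exact_mod_cast hjl
    have h3 := mul_nonpos_of_nonpos_of_nonneg hb h2
    simp only [add_zero] at h1
    linarith

theorem faceLengthsOn_left (h : IsConcatWalk s u v) (hu : u ∈ FaceEvent c (Set.Ioi 0))
    (hv : v ∈ FaceEvent d (Set.Iic 0)) : faceLengthsOn (l + r) s 0 l = (c.blocks : Multiset ℕ) :=
  faceLengthsOn_eq_blocks (zero_add l).symm c fun k hk => by
    rw [zero_add]
    exact h.mem_contactTimes_left hu hv hk

theorem faceLengthsOn_right (h : IsConcatWalk s u v) (hu : u ∈ FaceEvent c (Set.Ioi 0))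
    (hv : v ∈ FaceEvent d (Set.Iic 0)) :
    faceLengthsOn (l + r) s l (l + r) = (d.blocks : Multiset ℕ) :=
  faceLengthsOn_eq_blocks rfl d fun _ hk => h.mem_contactTimes_right hu hv hk

/-- Since `l` is a contact time, no face straddles it; tangents then force positive slope to its
left and nonpositive slope to its right. -/
theorem posFaceCount_eq (h : IsConcatWalk s u v) (hu : u ∈ FaceEvent c (Set.Ioi 0))
    (hv : v ∈ FaceEvent d (Set.Iic 0)) (j : ℕ) :
    posFaceCount (l + r) s j = (c.blocks : Multiset ℕ).count j := by
  classical
  rw [← h.faceLengthsOn_left hu hv, faceLengthsOn, Multiset.count_map, ← Finset.filter_val,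
    ← Finset.card_def, Finset.filter_filter, posFaceCount]
  congr 1
  refine Finset.filter_congr fun e he => ?_
  simp only [majorantFaces, Finset.mem_filter, Finset.mem_product] at he
  obtain ⟨⟨he1, he2⟩, hlt, hbt⟩ := he
  have hlen : (0 : ℝ) < (faceLength e : ℝ) := by
    unfold faceLength
    exact_mod_cast Nat.sub_pos_of_lt hlt
  have hlt' : (0 : ℝ) < (e.2 : ℝ) - e.1 := by
    rw [sub_pos]
    exact_mod_cast hlt
  have hn : ∀ k ∈ contactTimes (l + r) s, k ≤ l + r := fun k hk =>
    Nat.lt_succ_iff.1 (Finset.mem_range.1 (Finset.mem_filter.1 hk).1)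
  have hsign : 0 < faceSlope s e ↔ 0 < s e.2 - s e.1 := by
    rw [faceSlope, div_pos_iff_of_pos_right hlen]
  rw [hsign, and_comm, eq_comm (a := j)]
  refine and_congr_left fun _ => ?_
  simp only [zero_le, true_and]
  by_cases hel : e.2 ≤ l
  · refine iff_of_true ?_ hel
    obtain ⟨a, ha, hle⟩ := h.tangent_left hu hv hel ((h.mem_contactTimes_left hu hv hel).1 he2)
    rcases ha with ⟨hl, -⟩ | ha
    · omega
    · have h1 := hle e.1 (by omega)
      have h2 := mul_pos ha hlt'
      linarith
  · refine iff_of_false ?_ hel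
    have hl : l ∈ contactTimes (l + r) s :=
      (h.mem_contactTimes_left hu hv le_rfl).2 (isBoundary_self c)
    have hle1 : l ≤ e.1 := by
      by_contra! h'
      exact hbt l hl ⟨h', by omega⟩
    obtain ⟨k, hk⟩ := Nat.exists_eq_add_of_le hle1
    have hkr : k ≤ r := by
      have := hn _ he1
      omega
    rw [hk] at he1
    obtain ⟨a, ha, hle⟩ := h.tangent_right hu hv hkr ((h.mem_contactTimes_right hu hv hkr).1 he1)
    rw [← hk] at hle
    have h1 := hle e.2 (hn _ he2)
    have h2 := mul_nonpos_of_nonpos_of_nonneg ha hlt'.le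
    linarith

/-- The last face is the least steep, and it rises because the first maximum strictly exceeds the
value at the preceding block end. On the right, dually, the first face is steepest and cannot rise.
-/
theorem faceEvent_left_of_argmaxTime (h : IsConcatWalk s u v) (hu : u ∈ FaceEvent c Set.univ)
    (hmax : argmaxTime (l + r) s = l) : u ∈ FaceEvent c (Set.Ioi 0) := by
  refine ⟨hu.1, hu.2.1, fun i => ?_⟩
  obtain ⟨-, -, hlt⟩ := argmaxTime_eq_iff.1 hmax
  have hi := i.2
  let t : Fin c.length := ⟨c.length - 1, by omega⟩
  have ht : (t : ℕ) + 1 = c.length := Nat.sub_add_cancel (by omega)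
  have h1 := walk_sizeUpTo_succ c u t
  have h2 := c.sizeUpTo_strict_mono t.2
  rw [ht, c.sizeUpTo_length] at h1 h2
  have h3 := hlt _ h2
  rw [h.left l le_rfl, h.left _ h2.le] at h3
  have h4 : 0 < chordSlope (u ∘ c.embedding t) :=
    pos_of_mul_pos_right (by linarith) (Nat.cast_nonneg (c.blocksFun t))
  refine h4.trans_le (hu.2.1.antitone (?_ : i ≤ t))
  exact Fin.le_def.2 (by omega)

theorem faceEvent_right_of_argmaxTime (h : IsConcatWalk s u v) (hv : v ∈ FaceEvent d Set.univ)
    (hmax : argmaxTime (l + r) s = l) : v ∈ FaceEvent d (Set.Iic 0) := by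
  refine ⟨hv.1, hv.2.1, fun i => ?_⟩
  obtain ⟨-, hle, -⟩ := argmaxTime_eq_iff.1 hmax
  have hi := i.2
  let t : Fin d.length := ⟨0, by omega⟩
  have h1 := walk_sizeUpTo_succ d v t
  have h2 := d.sizeUpTo_le (t + 1)
  have h3 := hle (l + d.sizeUpTo (t + 1)) (by omega)
  rw [h.right _ h2, h.left l le_rfl, h1] at h3
  have h0 : walk v (d.sizeUpTo t) = 0 := by
    change walk v (d.sizeUpTo 0) = 0
    rw [d.sizeUpTo_zero, walk_zero]
  have h5 : (0 : ℝ) < d.blocksFun t := by exact_mod_cast d.one_le_blocksFun t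
  have h4 : chordSlope (v ∘ d.embedding t) ≤ 0 :=
    nonpos_of_mul_nonpos_right (by linarith) h5
  exact le_trans (hv.2.1.antitone (Fin.le_def.2 (Nat.zero_le i) : t ≤ i)) h4

end IsConcatWalk

theorem isConcatWalk_walk {n l r : ℕ} (hn : l + r = n) (x : Fin n → ℝ) :
    IsConcatWalk (walk x) (fun i : Fin l => x ⟨i, by omega⟩)
      (fun i : Fin r => x ⟨l + i, by omega⟩) := by
  have hleft : ∀ j ≤ l, walk x j = walk (fun i : Fin l => x ⟨i, by omega⟩) j := by
    intro j hj
    induction j with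
    | zero => simp [walk_zero]
    | succ j ih => rw [walk_succ x j (by omega), walk_succ _ j (by omega), ih (by omega)]
  refine ⟨hleft, fun j hj => ?_⟩
  induction j with
  | zero => simpa [walk_zero] using hleft l le_rfl
  | succ j ih =>
    rw [← add_assoc, walk_succ x _ (by omega), walk_succ _ j (by omega), ih (by omega), add_assoc]

/-! ### Probabilities of the joint face events -/

theorem measureReal_biUnion_faceEvent (μ : Measure ℝ) [IsProbabilityMeasure μ] {m : ℕ} {A : Set ℝ}
    (hA : MeasurableSet A) (C : Finset (Composition m)) :
    (Measure.pi fun _ : Fin m => μ).real (⋃ c ∈ C, FaceEvent c A)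
      = ∑ c ∈ C, (Measure.pi fun _ : Fin m => μ).real (FaceEvent c A) :=
  measureReal_biUnion_finset (fun _ _ _ _ h => disjoint_faceEvent h A A)
    fun c _ => measurableSet_faceEvent c hA

/-- No face structure is constructed: the events are disjoint, and with `θ = 1` their masses add up
to `m! / m! = 1`. -/
theorem ae_exists_mem_faceEvent (μ : Measure ℝ) [IsProbabilityMeasure μ] [NullSingletonClass μ]
    (m : ℕ) : ∀ᵐ x ∂Measure.pi fun _ : Fin m => μ, ∃ c, x ∈ FaceEvent c Set.univ := by
  have h1 : (Measure.pi fun _ : Fin m => μ).real (⋃ c ∈ Finset.univ, FaceEvent c Set.univ) = 1 := by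
    rw [measureReal_biUnion_faceEvent μ .univ, sum_faceEvent μ .univ (θ := 1) (by simp),
      sum_ewensWeight]
    have h2 : (∏ i ∈ Finset.range m, (1 + (i : ℝ))) = m.factorial := by
      rw [← Finset.prod_range_add_one_eq_factorial]
      push_cast
      exact Finset.prod_congr rfl fun i _ => add_comm _ _
    rw [h2, div_self]
    exact_mod_cast Nat.factorial_ne_zero m
  have hm : MeasurableSet (⋃ c ∈ Finset.univ, FaceEvent (m := m) c Set.univ) :=
    Finset.measurableSet_biUnion _ fun c _ => measurableSet_faceEvent c .univ
  have h3 := probReal_compl_eq_one_sub (μ := Measure.pi fun _ : Fin m => μ) hm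
  rw [h1, sub_self] at h3
  rw [measureReal_eq_zero_iff, measure_eq_zero_iff_ae_notMem] at h3
  filter_upwards [h3] with x hx
  simpa using hx

theorem measurableSet_argmaxTime_eq (n l : ℕ) :
    MeasurableSet {x : Fin n → ℝ | argmaxTime n (walk x) = l} := by
  simp only [argmaxTime_eq_iff, Set.ofPred_and, Set.ofPred_forall]
  refine .inter (.const _) (.inter (.iInter fun j => .iInter fun _ => ?_)
    (.iInter fun j => .iInter fun _ => ?_))
  · exact measurableSet_le (measurable_walk j) (measurable_walk l)
  · exact measurableSet_lt (measurable_walk j) (measurable_walk l)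

theorem exists_common_law {Ω : Type*} [MeasurableSpace Ω] (P : Measure Ω) [IsProbabilityMeasure P]
    {n : ℕ} {X : Fin n → Ω → ℝ} (hX : ∀ i, Measurable (X i))
    (hident : ∀ i j, IdentDistrib (X i) (X j) P P)
    (hcont : ∀ i, ∀ x : ℝ, P {ω | X i ω = x} = 0) :
    ∃ μ : Measure ℝ, IsProbabilityMeasure μ ∧ NullSingletonClass μ ∧ ∀ i, P.map (X i) = μ := by
  obtain _ | n := n
  -- With no increments any atomless probability measure will do.
  · exact ⟨gaussianReal 0 1, inferInstance, nullSingletonClass_gaussianReal one_ne_zero,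
      fun i => i.elim0⟩
  · refine ⟨P.map (X 0), Measure.isProbabilityMeasure_map (hX 0).aemeasurable, ⟨fun x => ?_⟩,
      fun i => (hident i 0).map_eq⟩
    rw [Measure.map_apply (hX 0) (measurableSet_singleton x)]
    exact hcont 0 x

theorem map_pair_eq_prod_pi {Ω : Type*} [MeasurableSpace Ω] (P : Measure Ω)
    [IsProbabilityMeasure P] {n l r : ℕ} (hn : l + r = n) {X : Fin n → Ω → ℝ}
    (hX : ∀ i, Measurable (X i)) (hindep : iIndepFun X P) {μ : Measure ℝ} [IsProbabilityMeasure μ]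
    (hμ : ∀ i, P.map (X i) = μ) :
    P.map (fun ω => ((fun i : Fin l => X ⟨i, by omega⟩ ω),
      (fun i : Fin r => X ⟨l + i, by omega⟩ ω)))
      = (Measure.pi fun _ => μ).prod (Measure.pi fun _ => μ) := by
  subst hn
  have h1 := hindep.precomp (finSumFinEquiv (m := l) (n := r)).injective
  rw [iIndepFun_iff_map_fun_eq_pi_map fun i => (hX _).aemeasurable] at h1
  simp only [hμ] at h1
  have h2 := (measurePreserving_sumPiEquivProdPi (X := fun _ : Fin l ⊕ Fin r => ℝ)
    fun _ => μ).map_eq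
  rw [← h1, Measure.map_map (MeasurableEquiv.measurable _)
    (measurable_pi_lambda _ fun i => hX _)] at h2
  exact h2

theorem pi_real_chordSlope_pos {Ω : Type*} [MeasurableSpace Ω] (P : Measure Ω)
    [IsProbabilityMeasure P] {n : ℕ} {X : Fin n → Ω → ℝ}
    (hX : ∀ i, Measurable (X i)) (hindep : iIndepFun X P) {μ : Measure ℝ} [IsProbabilityMeasure μ]
    (hμ : ∀ i, P.map (X i) = μ) {k : ℕ} (hk : 1 ≤ k) (hkn : k ≤ n) :
    (Measure.pi fun _ : Fin k => μ).real {y | chordSlope y ∈ Set.Ioi 0}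
      = P.real {ω | 0 < walk (fun i => X i ω) k} := by
  have hkn' : k + (n - k) = n := by omega
  have h1 := congrArg (Measure.map Prod.fst) (map_pair_eq_prod_pi P hkn' hX hindep hμ)
  rw [measurePreserving_fst.map_eq, Measure.map_map measurable_fst
    ((measurable_pi_lambda _ fun i => hX _).prodMk (measurable_pi_lambda _ fun i => hX _))] at h1
  have hm : MeasurableSet {y : Fin k → ℝ | chordSlope y ∈ Set.Ioi 0} :=
    measurable_chordSlope measurableSet_Ioi
  rw [← h1, map_measureReal_apply (measurable_fst.comp
    ((measurable_pi_lambda _ fun i => hX _).prodMk (measurable_pi_lambda _ fun i => hX _))) hm]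
  congr 1
  ext ω
  have h2 := (isConcatWalk_walk hkn' fun i => X i ω).left k le_rfl
  have hk' : (0 : ℝ) < k := by exact_mod_cast hk
  simp only [Set.mem_preimage, Set.mem_ofPred_eq, Set.mem_Ioi, Function.comp_apply, chordSlope,
    h2, div_pos_iff_of_pos_right hk']

/-- Given the time of the maximum, the faces before and after it are independent. -/
theorem measureReal_argmaxTime_inter {Ω : Type*} [MeasurableSpace Ω] (P : Measure Ω)
    [IsProbabilityMeasure P] {l r : ℕ} {s : Ω → ℕ → ℝ} {u : Ω → Fin l → ℝ} {v : Ω → Fin r → ℝ}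
    (hs : ∀ ω, IsConcatWalk (s ω) (u ω) (v ω)) (hu : Measurable u) (hv : Measurable v)
    (μ : Measure ℝ) [IsProbabilityMeasure μ] [NullSingletonClass μ]
    (hlaw : P.map (fun ω => (u ω, v ω)) = (Measure.pi fun _ => μ).prod (Measure.pi fun _ => μ))
    (C : Finset (Composition l)) (D : Finset (Composition r)) {R : Set Ω}
    (hR : ∀ ω c d, u ω ∈ FaceEvent c (Set.Ioi 0) → v ω ∈ FaceEvent d (Set.Iic 0) →
      (ω ∈ R ↔ c ∈ C ∧ d ∈ D)) :
    P.real ({ω | argmaxTime (l + r) (s ω) = l} ∩ R)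
      = (∑ c ∈ C, (Measure.pi fun _ => μ).real (FaceEvent c (Set.Ioi 0)))
        * ∑ d ∈ D, (Measure.pi fun _ => μ).real (FaceEvent d (Set.Iic 0)) := by
  rw [← measureReal_biUnion_faceEvent μ measurableSet_Ioi,
    ← measureReal_biUnion_faceEvent μ measurableSet_Iic, ← measureReal_prod_prod, ← hlaw,
    map_measureReal_apply (hu.prodMk hv)
      ((Finset.measurableSet_biUnion _ fun c _ => measurableSet_faceEvent c measurableSet_Ioi).prod
        (Finset.measurableSet_biUnion _ fun c _ => measurableSet_faceEvent c measurableSet_Iic))]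
  refine measureReal_congr ?_
  have hmapu : P.map u = Measure.pi fun _ => μ := by
    have h := congrArg (Measure.map Prod.fst) hlaw
    rwa [measurePreserving_fst.map_eq, Measure.map_map measurable_fst (hu.prodMk hv)] at h
  have hmapv : P.map v = Measure.pi fun _ => μ := by
    have h := congrArg (Measure.map Prod.snd) hlaw
    rwa [measurePreserving_snd.map_eq, Measure.map_map measurable_snd (hu.prodMk hv)] at h
  have hau := ae_exists_mem_faceEvent μ l
  have hav := ae_exists_mem_faceEvent μ r
  rw [← hmapu] at hau
  rw [← hmapv] at hav
  filter_upwards [ae_of_ae_map hu.aemeasurable hau, ae_of_ae_map hv.aemeasurable hav]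
    with ω ⟨c, hc⟩ ⟨d, hd⟩
  -- Off a null set both stretches have a face structure; the position of the maximum then amounts
  -- to the sign conditions on the slopes.
  refine propext ⟨?_, ?_⟩
  · rintro ⟨hmax, hωR⟩
    have hc' := (hs ω).faceEvent_left_of_argmaxTime hc hmax
    have hd' := (hs ω).faceEvent_right_of_argmaxTime hd hmax
    obtain ⟨h1, h2⟩ := (hR ω c d hc' hd').1 hωR
    exact ⟨Set.mem_biUnion h1 hc', Set.mem_biUnion h2 hd'⟩
  · rintro ⟨h1, h2⟩
    obtain ⟨c', hcC, hc'⟩ := Set.mem_iUnion₂.1 h1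
    obtain ⟨d', hdD, hd'⟩ := Set.mem_iUnion₂.1 h2
    exact ⟨(hs ω).argmaxTime_eq hc' hd', (hR ω c' d' hc' hd').2 ⟨hcC, hdD⟩⟩

theorem coe_blocks_eq_parts_iff {m : ℕ} (c : Composition m) (π : m.Partition) :
    (c.blocks : Multiset ℕ) = π.parts ↔ Nat.Partition.ofComposition m c = π := by
  rw [Nat.Partition.ext_iff]
  rfl

theorem forall_count_blocks_eq_iff {m : ℕ} (c : Composition m) (π : m.Partition) :
    (∀ j, 1 ≤ j → (c.blocks : Multiset ℕ).count j = π.parts.count j) ↔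
      Nat.Partition.ofComposition m c = π := by
  rw [← coe_blocks_eq_parts_iff, Multiset.ext]
  refine ⟨fun h j => ?_, fun h j _ => h j⟩
  rcases Nat.eq_zero_or_pos j with rfl | hj
  · rw [Multiset.count_eq_zero.2 fun h0 => (c.one_le_blocks h0).not_gt Nat.one_pos,
      Multiset.count_eq_zero.2 fun h0 => (π.parts_pos h0).false]
  · exact h j hj

/-! ### Conditioning on the time of the maximum -/

theorem mainTheorem7 {Ω : Type*} [MeasurableSpace Ω] (P : Measure Ω) [IsProbabilityMeasure P]
    (n : ℕ) (X : Fin n → Ω → ℝ) (hX : ∀ i, Measurable (X i))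
    (hindep : iIndepFun X P)
    (hident : ∀ i j, IdentDistrib (X i) (X j) P P)
    (hcont : ∀ i, ∀ x : ℝ, P {ω | X i ω = x} = 0)
    (S : Ω → ℕ → ℝ) (hS : S = fun ω => walk (fun i => X i ω))
    (p : ℝ) (hp : ∀ j, 1 ≤ j → j ≤ n → P.real {ω | 0 < S ω j} = p)
    (l : ℕ) (hl : l ≤ n) (hpos : P {ω | argmaxTime n (S ω) = l} ≠ 0) :
    (∀ π : l.Partition,
      (cond P {ω | argmaxTime n (S ω) = l}).real {ω | faceLengthsOn n (S ω) 0 l = π.parts}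
        = ewensFormula p π) ∧
    (∀ π : l.Partition,
      (cond P {ω | argmaxTime n (S ω) = l}).real
          {ω | ∀ j, 1 ≤ j → posFaceCount n (S ω) j = π.parts.count j}
        = ewensFormula p π) ∧
    (∀ π : (n - l).Partition,
      (cond P {ω | argmaxTime n (S ω) = l}).real {ω | faceLengthsOn n (S ω) l n = π.parts}
        = ewensFormula (1 - p) π) := by
  obtain ⟨μ, hμ1, hμ2, hμ⟩ := exists_common_law P hX hident hcont
  have hn : l + (n - l) = n := by omega
  let u : Ω → Fin l → ℝ := fun ω i => X ⟨i, by omega⟩ ω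
  let v : Ω → Fin (n - l) → ℝ := fun ω i => X ⟨l + i, by omega⟩ ω
  have hu : Measurable u := measurable_pi_lambda _ fun i => hX _
  have hv : Measurable v := measurable_pi_lambda _ fun i => hX _
  have hs : ∀ ω, IsConcatWalk (S ω) (u ω) (v ω) := fun ω => by
    rw [hS]
    exact isConcatWalk_walk hn fun i => X i ω
  have hlaw : P.map (fun ω => (u ω, v ω))
      = (Measure.pi fun _ => μ).prod (Measure.pi fun _ => μ) :=
    map_pair_eq_prod_pi P hn hX hindep hμ
  have hIoi : ∀ k, 1 ≤ k → k ≤ n →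
      (Measure.pi fun _ : Fin k => μ).real {y | chordSlope y ∈ Set.Ioi 0} = p := by
    intro k hk hkn
    rw [pi_real_chordSlope_pos P hX hindep hμ hk hkn, ← hp k hk hkn, hS]
  have hIic : ∀ k, 1 ≤ k → k ≤ n →
      (Measure.pi fun _ : Fin k => μ).real {y | chordSlope y ∈ Set.Iic 0} = 1 - p := by
    intro k hk hkn
    have hm : MeasurableSet {y : Fin k → ℝ | chordSlope y ∈ Set.Ioi 0} :=
      measurable_chordSlope measurableSet_Ioi
    rw [← hIoi k hk hkn, ← probReal_compl_eq_one_sub hm]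
    congr 1
    ext y
    simp
  have key : ∀ (C : Finset (Composition l)) (D : Finset (Composition (n - l))) {R : Set Ω},
      (∀ ω c d, u ω ∈ FaceEvent c (Set.Ioi 0) → v ω ∈ FaceEvent d (Set.Iic 0) →
        (ω ∈ R ↔ c ∈ C ∧ d ∈ D)) →
      P.real ({ω | argmaxTime n (S ω) = l} ∩ R)
        = (∑ c ∈ C, (Measure.pi fun _ => μ).real (FaceEvent c (Set.Ioi 0)))
          * ∑ d ∈ D, (Measure.pi fun _ => μ).real (FaceEvent d (Set.Iic 0)) := by
    intro C D R hR
    have h := measureReal_argmaxTime_inter P hs hu hv μ hlaw C D hR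
    rwa [hn] at h
  have hsumC := sum_faceEvent μ measurableSet_Ioi fun k hk hkl => hIoi k hk (hkl.trans hl)
  have hsumD := sum_faceEvent μ (m := n - l) measurableSet_Iic fun k hk hkl =>
    hIic k hk (by omega)
  have hL : MeasurableSet {ω | argmaxTime n (S ω) = l} := by
    rw [hS]
    exact measurable_pi_lambda (fun ω i => X i ω) hX (measurableSet_argmaxTime_eq n l)
  -- Allowing all compositions on both sides computes the probability of the conditioning event. It
  -- is nonzero, so both factors are, which permits the cancellations below even when `p` is `0` or
  -- `1`.
  have hPL := key Finset.univ Finset.univ (R := Set.univ) (by simp)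
  rw [Set.inter_univ, hsumC, hsumD] at hPL
  have hne : P.real {ω | argmaxTime n (S ω) = l} ≠ 0 := by
    rwa [ne_eq, measureReal_eq_zero_iff]
  rw [hPL] at hne
  have hcond : ∀ R : Set Ω, (cond P {ω | argmaxTime n (S ω) = l}).real R
      = P.real ({ω | argmaxTime n (S ω) = l} ∩ R) / P.real {ω | argmaxTime n (S ω) = l} := by
    intro R
    rw [measureReal_def, cond_apply hL, ENNReal.toReal_mul, ENNReal.toReal_inv, div_eq_inv_mul]
    rfl
  have hleft : ∀ (π : l.Partition) {R : Set Ω},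
      (∀ ω c d, u ω ∈ FaceEvent c (Set.Ioi 0) → v ω ∈ FaceEvent d (Set.Iic 0) →
        (ω ∈ R ↔ Nat.Partition.ofComposition l c = π)) →
      (cond P {ω | argmaxTime n (S ω) = l}).real R = ewensFormula p π := by
    intro π R hR
    rw [hcond, hPL, key {c | Nat.Partition.ofComposition l c = π} Finset.univ
      (fun ω c d hc hd => by simpa using hR ω c d hc hd), hsumD,
      sum_faceEvent_of_partition μ measurableSet_Ioi fun k hk hkl => hIoi k hk (hkl.trans hl),
      mul_div_mul_right _ _ (right_ne_zero_of_mul hne), ewensFormula_eq_div]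
  refine ⟨fun π => hleft π fun ω c d hc hd => ?_, fun π => hleft π fun ω c d hc hd => ?_,
    fun π => ?_⟩
  · have h := (hs ω).faceLengthsOn_left hc hd
    rw [hn] at h
    rw [Set.mem_ofPred_eq, h, coe_blocks_eq_parts_iff]
  · have h := (hs ω).posFaceCount_eq hc hd
    rw [hn] at h
    simp only [Set.mem_ofPred_eq, h, forall_count_blocks_eq_iff]
  · rw [hcond, hPL, key Finset.univ {d | Nat.Partition.ofComposition (n - l) d = π}
      (fun ω c d hc hd => ?_), hsumC,
      sum_faceEvent_of_partition μ measurableSet_Iic fun k hk hkl => hIic k hk (by omega),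
      mul_div_mul_left _ _ (left_ne_zero_of_mul hne), ewensFormula_eq_div]
    have h := (hs ω).faceLengthsOn_right hc hd
    rw [hn] at h
    rw [Set.mem_ofPred_eq, h, coe_blocks_eq_parts_iff]
    simp
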